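/- **Setting.** Let $n\ge 1$. A *proper cone* in a finite-dimensional real vector space is a closed set $K$ that is closed under addition and under multiplication by scalars $\alpha\ge 0$, with $K\cap(-K)=\{0\}$ and $\operatorname{int}K\neq\emptyset$. A *totally positive structure* on $\mathbb R^n$ is a family $\{K_1,\dots,K_n\}$ of proper cones $K_j\subset\wedge^j\mathbb R^n$ (with $\wedge^1\mathbb R^n=\mathbb R^n$). A linear operator $A:\mathbb R^n\to\mathbb R^n$ is *generalized strictly totally positive (GSTP)* with respect to $\{K_1,\dots,K_n\}$ if $(\wedge^jA)(K_j\setminus\{0\})\subseteq\operatorname{int}(K_j)$ for every $j=1,\dots,n$. Define successively $T(K_1)=K_1\cup(-K_1)$ and, for $2\le j\le n$, let $T(K_1,\dots,K_j)$ be the closure of the set of all $x_1\in\mathbb R^n$ for which there exist $x_2\in T(K_1),\ x_3\in T(K_1,K_2),\ \dots,\ x_j\in T(K_1,\dots,K_{j-1})$ with $x_1\wedge x_2\wedge\dots\wedge x_j\in\operatorname{int}(K_j)\cup\operatorname{int}(-K_j)$. For the empty list of cones put $T(K_1,\dots,K_0)=\{0\}$. **Theorem 22 (generalized Gantmacher–Krein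 theorem).** Let $A:\mathbb R^n\to\mathbb R^n$ be GSTP with respect to a totally positive structure $\{K_1,\dots,K_n\}$. Then all the (complex) eigenvalues of $A$ are positive and (algebraically) simple: $$\rho(A)=\lambda_1>\lambda_2>\dots>\lambda_n>0,$$ where $\rho(A)$ is the spectral radius. Let $x_1,\dots,x_n$ be any eigenvectors of $A$ corresponding to $\lambda_1,\dots,\lambda_n$. Then $x_1$, up to its sign, belongs to $\operatorname{int}(K_1)$, that is, $x_1\in\operatorname{int}(K_1)$ or $-x_1\in\operatorname{int}(K_1)$; and for every $j=1,\dots,n$ $$x_j\in\operatorname{int}(T(K_1,\dots,K_j))\setminus T(K_1,\dots,K_{j-1}).$$ Moreover, for all $1\le q\le p\le n$ and all real $c_q,\dots,c_p$ with $c_p\ne 0$, $$\sum_{i=q}^p c_ix_i\in\operatorname{int}(T(K_1,\dots,K_p))\setminus T(K_1,\dots,K_{q-1}),$$ and for all $1\le q\le p\le n$ and all real $c_q,\dots,c_p$, $$\sum_{i=q}^p c_ix_i\in\overline{T(K_1,\dots,K_p)\setminus T(K_1,\dots,K_{q-1})}.$$ -/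

import Mathlib

open scoped Pointwise

/-- Euclidean space of dimension `n`. -/
abbrev Euc (n : ℕ) : Type := EuclideanSpace ℝ (Fin n)

/-- The `j`-th exterior power of Euclidean `n`-space. -/
abbrev ExtPow (n j : ℕ) : Type := ↥(⋀[ℝ]^j (Euc n))

/-- The usual topology of the finite-dimensional real vector space `ExtPow n j`: the module
topology, which in finite dimension is the only Hausdorff vector space topology. -/
instance ExtPow.instTopologicalSpace (n j : ℕ) : TopologicalSpace (ExtPow n j) :=
  moduleTopology ℝ (ExtPow n j)

instance ExtPow.instIsModuleTopology (n j : ℕ) : IsModuleTopology ℝ (ExtPow n j) := ⟨rfl⟩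

/-- The exterior product `x₁ ∧ … ∧ xⱼ`. -/
noncomputable def wedge {n j : ℕ} (x : Fin j → Euc n) : ExtPow n j :=
  exteriorPower.ιMulti ℝ j x

/-- Proper cones: closed convex cones that are pointed and solid. -/
structure IsProperCone {V : Type*} [AddCommGroup V] [Module ℝ V] [TopologicalSpace V]
    (K : Set V) : Prop where
  isClosed : IsClosed K
  add_mem : ∀ x ∈ K, ∀ y ∈ K, x + y ∈ K
  smul_mem : ∀ x ∈ K, ∀ a : ℝ, 0 ≤ a → a • x ∈ K
  pointed : K ∩ -K = {0}
  solid : (interior K).Nonempty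

/-- A linear operator is positive with respect to `K` if it maps `K \ {0}` into the
interior of `K`. -/
def IsConePositive {V : Type*} [AddCommGroup V] [Module ℝ V] [TopologicalSpace V]
    (K : Set V) (A : V →ₗ[ℝ] V) : Prop :=
  Set.MapsTo A (K \ {0}) (interior K)

/-- A totally positive structure `{K₁, …, Kₙ}`: a proper cone `Kⱼ` in the `j`-th exterior power
for each `1 ≤ j ≤ n` (the values of `K` outside this range play no role). -/
def IsTotallyPositiveStructure {n : ℕ} (K : ∀ j : ℕ, Set (ExtPow n j)) : Prop :=
  ∀ j : ℕ, 1 ≤ j → j ≤ n → IsProperCone (K j)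

/-- `A` is generalized strictly totally positive with respect to `{K₁, …, Kₙ}`: its `j`-th
exterior power is positive with respect to `Kⱼ` for each `1 ≤ j ≤ n`. -/
def IsGSTP {n : ℕ} (K : ∀ j : ℕ, Set (ExtPow n j)) (A : Euc n →ₗ[ℝ] Euc n) : Prop :=
  ∀ j : ℕ, 1 ≤ j → j ≤ n → IsConePositive (K j) (exteriorPower.map j A)

/-- `K₁` as a subset of Euclidean space, under the identification of the first exterior power
with the space itself. -/
def firstCone {n : ℕ} (K : ∀ j : ℕ, Set (ExtPow n j)) : Set (Euc n) :=
  {x | wedge ![x] ∈ K 1}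

/-- The sets `T(K₁, …, Kⱼ)`. One has `T(K₁) = K₁ ∪ (-K₁)`, and for `j ≥ 2` the set
`T(K₁, …, Kⱼ)` is the closure of the set of all `x₁` for which there are
`x₂ ∈ T(K₁)`, …, `xⱼ ∈ T(K₁, …, Kⱼ₋₁)` with `x₁ ∧ x₂ ∧ … ∧ xⱼ ∈ int Kⱼ ∪ int (-Kⱼ)`.
For the empty list of cones the set is `{0}`. -/
def TSet {n : ℕ} (K : ∀ j : ℕ, Set (ExtPow n j)) : ℕ → Set (Euc n)
  | 0 => {0}
  | 1 => firstCone K ∪ -firstCone K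
  | j + 2 => closure {x | ∃ y : Fin (j + 1) → Euc n, (∀ i : Fin (j + 1), y i ∈ TSet K (i + 1)) ∧
      wedge (Fin.cons x y : Fin (j + 2) → Euc n) ∈ interior (K (j + 2)) ∪ interior (-K (j + 2))}
  decreasing_by omega

/-! Perron–Frobenius applies to every exterior power: ⋀^j A has a simple dominant eigenvalue μ_j, an
eigenvector w_j interior to K_j and a left eigenvector φ_j positive on K_j \ {0}, and μ_j^(-m) (⋀^j
A)^m converges to v ↦ φ_j(v) w_j. Everything else is read off from this convergence, with μ_0 = 1
and λ_j = μ_j / μ_(j-1).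

Eigenvectors are split off one at a time, over ℝ (`IsDominant.exists_eigenvector_step`). Given x_1,
…, x_j and an invariant complement U, the functional u ↦ φ_(j+1)(u ∧ x_1 ∧ … ∧ x_j) is a left
eigenvector for λ_(j+1). On its kernel in U, the iterates of A are o(λ_(j+1)^m); it is nonzero on U,
since otherwise φ_(j+1) would vanish. So U contains an eigenvector for λ_(j+1) and all the rest
decays. The n distinct positive eigenvalues so obtained exhaust the characteristic polynomial.

For s = ∑ c_i x_i over q ≤ i ≤ p with c_p ≠ 0, the product s ∧ x_1 ∧ … ∧ x_(p-1) is a nonzero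
eigenvector for μ_p, hence a multiple of w_p, and lies in ± int K_p; openness in the first factor
puts s in the interior of T(K_1, …, K_p). For q > 1, s decays relative to λ_(q-1), so φ_(q-1)(s ∧ ω)
= 0 for all ω. A compactness argument shows that no such s ≠ 0 is a limit of vectors dividing
nonzero elements of ± K_(q-1) (`notMem_closure_of_apply_wedgeLeft_eq_zero`), which excludes s from
T(K_1, …, K_(q-1)). -/

open Filter Topology

/-! ### Proper cones and the positive eigenvector -/

section Cone

namespace IsProperCone

section TopologicalVectorSpace

variable {V : Type*} [AddCommGroup V] [Module ℝ V] [TopologicalSpace V] {K : Set V}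

theorem zero_mem (hK : IsProperCone K) : (0 : V) ∈ K := by
  have h : (0 : V) ∈ K ∩ -K := by rw [hK.pointed]; rfl
  exact h.1

theorem eq_zero_of_neg_mem (hK : IsProperCone K) {x : V} (hx : x ∈ K) (hx' : -x ∈ K) : x = 0 := by
  have h : x ∈ K ∩ -K := ⟨hx, hx'⟩
  rwa [hK.pointed] at h

theorem nonneg_of_smul_mem (hK : IsProperCone K) {w : V} (hw : w ∈ K) (hw0 : w ≠ 0) {a : ℝ}
    (h : a • w ∈ K) : 0 ≤ a := by
  by_contra! ha
  have h1 := hK.smul_mem _ h (-a)⁻¹ (by rw [inv_nonneg]; linarith)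
  rw [smul_smul, inv_neg, neg_mul, inv_mul_cancel₀ ha.ne, neg_one_smul] at h1
  exact hw0 (hK.eq_zero_of_neg_mem hw h1)

variable [ContinuousSMul ℝ V]

theorem smul_mem_interior (hK : IsProperCone K) {x : V} (hx : x ∈ interior K) {a : ℝ}
    (ha : 0 < a) : a • x ∈ interior K := by
  have h : (fun z => a • z) '' interior K ⊆ interior K := by
    refine interior_maximal ?_ ?_
    · rintro _ ⟨z, hz, rfl⟩
      exact hK.smul_mem _ (interior_subset hz) _ ha.le
    · exact (Homeomorph.smulOfNeZero a ha.ne').isOpenMap _ isOpen_interior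
  exact h ⟨x, hx, rfl⟩

variable [IsTopologicalAddGroup V]

theorem exists_sub_smul_mem {x : V} (hx : x ∈ interior K) (w : V) :
    ∃ t : ℝ, 0 < t ∧ x - t • w ∈ K := by
  have h : Tendsto (fun t : ℝ => x - t • w) (𝓝[>] 0) (𝓝 x) := by
    have : Continuous fun t : ℝ => x - t • w := by fun_prop
    simpa using (this.tendsto 0).mono_left nhdsWithin_le_nhds
  have h2 := (h.eventually (mem_interior_iff_mem_nhds.1 hx)).and self_mem_nhdsWithin
  obtain ⟨t, ht, ht'⟩ := h2.exists
  exact ⟨t, ht', ht⟩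

theorem ne_zero_of_mem_interior [Nontrivial V] (hK : IsProperCone K) {x : V}
    (hx : x ∈ interior K) : x ≠ 0 := by
  rintro rfl
  obtain ⟨v, hv⟩ := exists_ne (0 : V)
  obtain ⟨t, ht, h⟩ := exists_sub_smul_mem hx v
  obtain ⟨s, hs, h'⟩ := exists_sub_smul_mem hx (-v)
  apply hv
  have h1 : t • v ∈ K := by
    have := hK.smul_mem _ h' (t / s) (by positivity)
    simpa [smul_smul, div_mul_cancel₀ _ hs.ne'] using this
  have h2 := hK.eq_zero_of_neg_mem h1 (by simpa using h)
  exact (smul_eq_zero.1 h2).resolve_left ht.ne'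

end TopologicalVectorSpace

variable {V : Type*} [NormedAddCommGroup V] [NormedSpace ℝ V] {K : Set V}

theorem inv_norm_smul_mem (hK : IsProperCone K) {x : V} (hx : x ∈ K) (h0 : x ≠ 0) :
    ‖x‖⁻¹ • x ∈ K ∩ Metric.sphere 0 1 := by
  refine ⟨hK.smul_mem _ hx _ (by positivity), ?_⟩
  simp [norm_smul, norm_ne_zero_iff.2 h0]

variable [FiniteDimensional ℝ V]

theorem isCompact_sphere_inter (hK : IsProperCone K) : IsCompact (K ∩ Metric.sphere 0 1) := by
  have := FiniteDimensional.proper ℝ V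
  exact (isCompact_sphere _ _).inter_left hK.isClosed

/-- A proper cone is normal. -/
theorem exists_norm_le (hK : IsProperCone K) :
    ∃ N : ℝ, 0 < N ∧ ∀ p ∈ K, ∀ q ∈ K, ‖p‖ ≤ N * ‖p + q‖ := by
  -- The negated unit base of K is compact and disjoint from K, hence at some distance δ from it. If
  -- ‖p + q‖ < δ‖p‖, then q/‖p‖ would be an element of K too close to -p/‖p‖.
  have hc : IsCompact (-(K ∩ Metric.sphere (0 : V) 1)) := hK.isCompact_sphere_inter.neg
  have hd : -(K ∩ Metric.sphere (0 : V) 1) ⊆ Kᶜ := by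
    rintro x ⟨hx, hx1⟩ hx'
    have := hK.eq_zero_of_neg_mem hx' hx
    simp [this] at hx1
  obtain ⟨δ, hδ, h⟩ := hc.exists_thickening_subset_open hK.isClosed.isOpen_compl hd
  refine ⟨δ⁻¹, by positivity, fun p hp q hq => ?_⟩
  rcases eq_or_ne p 0 with rfl | hp0
  · simp; positivity
  have hn : 0 < ‖p‖ := norm_pos_iff.2 hp0
  by_contra! hlt
  have hmem : ‖p‖⁻¹ • q ∈ Metric.thickening δ (-(K ∩ Metric.sphere (0 : V) 1)) := by
    rw [Metric.mem_thickening_iff]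
    refine ⟨-(‖p‖⁻¹ • p), by simpa using hK.inv_norm_smul_mem hp hp0, ?_⟩
    rw [dist_eq_norm, sub_neg_eq_add, ← smul_add, norm_smul, norm_inv, norm_norm, add_comm q p,
      inv_mul_lt_iff₀ hn]
    rwa [inv_mul_lt_iff₀ hδ, mul_comm] at hlt
  exact h hmem (hK.smul_mem _ hq _ (by positivity))

/-- A linear map that maps a proper cone positively does so with a uniform margin. -/
theorem exists_sub_norm_smul_mem (hK : IsProperCone K) {C : V →ₗ[ℝ] V} (hC : IsConePositive K C)
    (w : V) : ∃ δ : ℝ, 0 < δ ∧ ∀ x ∈ K, C x - (δ * ‖x‖) • w ∈ K := by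
  have hc : IsCompact (C '' (K ∩ Metric.sphere (0 : V) 1)) :=
    hK.isCompact_sphere_inter.image C.continuous_of_finiteDimensional
  have hd : C '' (K ∩ Metric.sphere (0 : V) 1) ⊆ interior K := by
    rintro _ ⟨x, ⟨hx, hx1⟩, rfl⟩
    refine hC ⟨hx, ?_⟩
    rintro rfl
    simp at hx1
  obtain ⟨δ, hδ, h⟩ := hc.exists_thickening_subset_open isOpen_interior hd
  -- Dividing the distance δ by ‖w‖ + 1 rather than ‖w‖ also covers w = 0 and keeps the inequality
  -- strict.
  have hw : 0 < ‖w‖ + 1 := by positivity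
  refine ⟨δ / (‖w‖ + 1), by positivity, fun x hx => ?_⟩
  rcases eq_or_ne x 0 with rfl | hx0
  · simpa using hK.zero_mem
  have hn : 0 < ‖x‖ := norm_pos_iff.2 hx0
  have hmem : C (‖x‖⁻¹ • x) - (δ / (‖w‖ + 1)) • w ∈ K := by
    refine interior_subset (h ?_)
    rw [Metric.mem_thickening_iff]
    refine ⟨_, ⟨_, hK.inv_norm_smul_mem hx hx0, rfl⟩, ?_⟩
    rw [dist_eq_norm, sub_sub_cancel_left, norm_neg, norm_smul, Real.norm_of_nonneg (by positivity),
      div_mul_eq_mul_div, div_lt_iff₀ hw]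
    nlinarith
  have := hK.smul_mem _ hmem ‖x‖ hn.le
  rwa [smul_sub, map_smul, smul_smul, mul_inv_cancel₀ hn.ne', one_smul, smul_smul,
    mul_comm ‖x‖] at this

/-- Existence of a positive eigenvector (Collatz–Wielandt). -/
theorem exists_eigenvector [Nontrivial V] (hK : IsProperCone K) {B : V →ₗ[ℝ] V}
    (hB : IsConePositive K B) : ∃ μ : ℝ, 0 < μ ∧ ∃ w ∈ interior K, B w = μ • w := by
  have hBc : Continuous B := B.continuous_of_finiteDimensional
  obtain ⟨N, hN, hnorm⟩ := hK.exists_norm_le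
  set Bc : V →L[ℝ] V := LinearMap.toContinuousLinearMap B
  obtain ⟨e, he⟩ := hK.solid
  have he0 := hK.ne_zero_of_mem_interior he
  have hpos : ∀ x ∈ K, x ≠ 0 → B x ∈ interior K := fun x hx h0 => hB ⟨hx, h0⟩
  -- The pairs with r x ≤ B x in the order of K. By normality the bound on r excludes nothing; it
  -- only makes S compact, so that a largest r is attained.
  let S : Set (ℝ × V) := {p | p.1 ∈ Set.Icc 0 (N * ‖Bc‖) ∧ p.2 ∈ K ∩ Metric.sphere 0 1 ∧
    B p.2 - p.1 • p.2 ∈ K}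
  have hmemS : ∀ (r : ℝ) (x : V), 0 ≤ r → x ∈ K → x ≠ 0 → B x - r • x ∈ K →
      (r, ‖x‖⁻¹ • x) ∈ S := by
    intro r x hr hx hx0 h
    have hn : 0 < ‖x‖ := norm_pos_iff.2 hx0
    refine ⟨⟨hr, ?_⟩, hK.inv_norm_smul_mem hx hx0, ?_⟩
    · have h1 := hnorm _ (hK.smul_mem _ hx r hr) _ h
      rw [add_sub_cancel, norm_smul, Real.norm_of_nonneg hr] at h1
      have h2 : ‖B x‖ ≤ ‖Bc‖ * ‖x‖ := Bc.le_opNorm x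
      have h3 : r * ‖x‖ ≤ N * ‖Bc‖ * ‖x‖ := by nlinarith
      exact le_of_mul_le_mul_right h3 hn
    · have := hK.smul_mem _ h ‖x‖⁻¹ (by positivity)
      simpa [smul_sub, smul_comm ‖x‖⁻¹ r] using this
  have hScomp : IsCompact S := by
    have : S = (Set.Icc 0 (N * ‖Bc‖) ×ˢ (K ∩ Metric.sphere 0 1)) ∩
        (fun p : ℝ × V => B p.2 - p.1 • p.2) ⁻¹' K := by
      ext p; simp [S, and_assoc]
    rw [this]
    exact (isCompact_Icc.prod hK.isCompact_sphere_inter).inter_right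
      (hK.isClosed.preimage (by fun_prop))
  have heK := interior_subset he
  have hSne : S.Nonempty :=
    ⟨_, hmemS 0 e le_rfl heK he0 (by simpa using interior_subset (hpos e heK he0))⟩
  obtain ⟨⟨r, x⟩, ⟨⟨hr0, hr⟩, ⟨hxK, hx1⟩, hx⟩, hmax⟩ :=
    hScomp.exists_isMaxOn hSne continuous_fst.continuousOn
  have hx0 : x ≠ 0 := by rintro rfl; simp at hx1
  have hBx := hpos x hxK hx0
  have hBx0 := hK.ne_zero_of_mem_interior hBx
  have hkey : B x - r • x = 0 := by
    by_contra hne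
    have h1 := hpos _ hx hne
    obtain ⟨t, ht, h2⟩ := exists_sub_smul_mem h1 (B x)
    have h3 : B (B x) - (r + t) • B x ∈ K := by
      rw [map_sub, map_smul] at h2
      rwa [add_smul, ← sub_sub]
    have h4 := hmax (hmemS (r + t) _ (by positivity) (interior_subset hBx) hBx0 h3)
    simp at h4
    linarith
  have hrx : B x = r • x := sub_eq_zero.1 hkey
  have hrpos : 0 < r := by
    refine lt_of_le_of_ne hr0 ?_
    rintro rfl
    exact hBx0 (by simpa using hrx)
  refine ⟨r, hrpos, B x, hBx, ?_⟩
  conv_lhs => rw [hrx, map_smul]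

end IsProperCone

end Cone

/-- Spectral data of an operator `B` with a simple strictly dominant eigenvalue `μ`: a left
eigenvector `φ` and a right eigenvector `w` with `φ w = 1`, such that the normalized powers of `B`
converge to the projection onto `w` along `ker φ`. -/
structure IsDominant {V : Type*} [AddCommGroup V] [Module ℝ V] [TopologicalSpace V]
    (B : V →ₗ[ℝ] V) (μ : ℝ) (φ : V →ₗ[ℝ] ℝ) (w : V) : Prop where
  pos : 0 < μ
  map_eq : B w = μ • w
  apply_self : φ w = 1
  apply_map : ∀ v, φ (B v) = μ * φ v
  tendsto : ∀ v, Tendsto (fun m : ℕ => (μ ^ m)⁻¹ • (B ^ m) v) atTop (𝓝 (φ v • w))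

/-- Perron–Frobenius data of an operator `B` that is positive with respect to a cone `K`: the
dominant right eigenvector is interior to `K`, and the left one is positive on `K`. -/
structure IsPerron {V : Type*} [AddCommGroup V] [Module ℝ V] [TopologicalSpace V]
    (K : Set V) (B : V →ₗ[ℝ] V) (μ : ℝ) (φ : V →ₗ[ℝ] ℝ) (w : V) : Prop
    extends IsDominant B μ φ w where
  mem_interior : w ∈ interior K
  apply_pos : ∀ x ∈ K, x ≠ 0 → 0 < φ x
  isCompact_slice : IsCompact {x ∈ K | φ x = 1}

/-! ### Convergence of powers and Perron–Frobenius data -/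

section Cone

variable {V : Type*} [NormedAddCommGroup V] [NormedSpace ℝ V] [FiniteDimensional ℝ V] {K : Set V}

namespace IsProperCone

/-- The powers of a positive operator fixing an interior vector `w` converge pointwise to
multiples of `w`. -/
theorem exists_tendsto_pow [Nontrivial V] (hK : IsProperCone K) {C : V →ₗ[ℝ] V}
    (hC : IsConePositive K C) {w : V} (hw : w ∈ interior K) (hCw : C w = w) (v : V) :
    ∃ L : ℝ, Tendsto (fun m : ℕ => (C ^ m) v) atTop (𝓝 (L • w)) ∧ (v ∈ K → 0 ≤ L) := by
  obtain ⟨N, hN, hnorm⟩ := hK.exists_norm_le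
  obtain ⟨δ, hδ, hmargin⟩ := hK.exists_sub_norm_smul_mem hC w
  have hw0 := hK.ne_zero_of_mem_interior hw
  have hwK := interior_subset hw
  have hwn : 0 < ‖w‖ := norm_pos_iff.2 hw0
  -- The contraction ratio of the order interval a_m w ≤ C^m v ≤ b_m w. Each application of C raises
  -- a_m and lowers b_m by δ times the norms of the two gaps, which sum to at least (b_m - a_m)‖w‖.
  set κ : ℝ := 1 - δ * ‖w‖ with hκ
  have hκ0 : 0 ≤ κ := by
    refine hK.nonneg_of_smul_mem hwK hw0 ?_
    have := hmargin w hwK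
    rwa [hCw, ← one_smul ℝ w, smul_smul, ← sub_smul, mul_one, one_smul] at this
  have hκ1 : κ < 1 := by have : 0 < δ * ‖w‖ := by positivity
                         linarith
  have hbound : ∀ v : V, ∃ b : ℝ, b • w - v ∈ K := by
    intro v
    obtain ⟨t, ht, h⟩ := exists_sub_smul_mem hw v
    refine ⟨t⁻¹, ?_⟩
    have := hK.smul_mem _ h t⁻¹ (by positivity)
    rwa [smul_sub, smul_smul, inv_mul_cancel₀ ht.ne', one_smul] at this
  obtain ⟨b₀, hb₀⟩ := hbound v
  -- Starting from 0 when v ∈ K makes the limit nonnegative on K.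
  obtain ⟨a₀, ha₀, ha₀'⟩ : ∃ a : ℝ, v - a • w ∈ K ∧ (v ∈ K → 0 ≤ a) := by
    by_cases hv : v ∈ K
    · exact ⟨0, by simpa using hv, fun _ => le_rfl⟩
    · obtain ⟨a, ha⟩ := hbound (-v)
      exact ⟨-a, by simpa [add_comm] using ha, fun h => absurd h hv⟩
  let a : ℕ → ℝ := fun m => Nat.rec a₀ (fun m r => r + δ * ‖(C ^ m) v - r • w‖) m
  let b : ℕ → ℝ := fun m => Nat.rec b₀ (fun m r => r - δ * ‖r • w - (C ^ m) v‖) m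
  have has : ∀ m, a (m + 1) = a m + δ * ‖(C ^ m) v - a m • w‖ := fun m => rfl
  have hbs : ∀ m, b (m + 1) = b m - δ * ‖b m • w - (C ^ m) v‖ := fun m => rfl
  have haK : ∀ m, (C ^ m) v - a m • w ∈ K := by
    intro m
    induction m with
    | zero => exact ha₀
    | succ m ih =>
      have := hmargin _ ih
      rwa [map_sub, map_smul, hCw, sub_sub, ← add_smul, ← has, ← Module.End.mul_apply,
        ← pow_succ'] at this
  have hbK : ∀ m, b m • w - (C ^ m) v ∈ K := by
    intro m
    induction m with
    | zero => exact hb₀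
    | succ m ih =>
      have := hmargin _ ih
      rwa [map_sub, map_smul, hCw, sub_right_comm, ← sub_smul, ← hbs, ← Module.End.mul_apply,
        ← pow_succ'] at this
  have hsum : ∀ m, ((C ^ m) v - a m • w) + (b m • w - (C ^ m) v) = (b m - a m) • w := by
    intro m; rw [sub_smul]; abel
  have hab : ∀ m, 0 ≤ b m - a m := fun m =>
    hK.nonneg_of_smul_mem hwK hw0 (hsum m ▸ hK.add_mem _ (haK m) _ (hbK m))
  have hmono : Monotone a := monotone_nat_of_le_succ fun m => by
    rw [has]; have : 0 ≤ δ * ‖(C ^ m) v - a m • w‖ := by positivity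
    linarith
  have hanti : Antitone b := antitone_nat_of_succ_le fun m => by
    rw [hbs]; have : 0 ≤ δ * ‖b m • w - (C ^ m) v‖ := by positivity
    linarith
  have hgeo : ∀ m, b m - a m ≤ κ ^ m * (b₀ - a₀) := by
    intro m
    induction m with
    | zero => simp [a, b]
    | succ m ih =>
      have h1 : (b m - a m) * ‖w‖ ≤ ‖(C ^ m) v - a m • w‖ + ‖b m • w - (C ^ m) v‖ := by
        have := norm_add_le ((C ^ m) v - a m • w) (b m • w - (C ^ m) v)
        rwa [hsum, norm_smul, Real.norm_of_nonneg (hab m)] at this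
      have h2 := mul_le_mul_of_nonneg_left h1 hδ.le
      calc b (m + 1) - a (m + 1) ≤ κ * (b m - a m) := by rw [has, hbs, hκ]; linarith
        _ ≤ κ * (κ ^ m * (b₀ - a₀)) := mul_le_mul_of_nonneg_left ih hκ0
        _ = _ := by ring
  have hbdd : BddAbove (Set.range a) := by
    refine ⟨b₀, ?_⟩
    rintro _ ⟨m, rfl⟩
    have h1 : b m ≤ b₀ := hanti (Nat.zero_le m)
    linarith [hab m]
  have hL := tendsto_atTop_ciSup hmono hbdd
  refine ⟨⨆ m, a m, ?_, fun hv => (ha₀' hv).trans (le_ciSup hbdd 0)⟩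
  have hz : Tendsto (fun m => (C ^ m) v - a m • w) atTop (𝓝 0) := by
    have h0 : Tendsto (fun m : ℕ => N * (κ ^ m * (b₀ - a₀) * ‖w‖)) atTop (𝓝 0) := by
      have := (((tendsto_pow_atTop_nhds_zero_of_lt_one hκ0 hκ1).mul_const (b₀ - a₀)).mul_const
        ‖w‖).const_mul N
      simpa using this
    refine squeeze_zero_norm (fun m => ?_) h0
    have := hnorm _ (haK m) _ (hbK m)
    rw [hsum, norm_smul, Real.norm_of_nonneg (hab m)] at this
    refine this.trans ?_
    gcongr
    exact hgeo m
  simpa using hz.add (hL.smul_const w)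

/-- The Perron–Frobenius theorem in a normed space. -/
theorem exists_isPerron_of_normed [Nontrivial V] (hK : IsProperCone K) {B : V →ₗ[ℝ] V}
    (hB : IsConePositive K B) : ∃ μ φ w, IsPerron K B μ φ w := by
  obtain ⟨μ, hμ, w, hw, hBw⟩ := hK.exists_eigenvector hB
  have hw0 := hK.ne_zero_of_mem_interior hw
  set C : V →ₗ[ℝ] V := μ⁻¹ • B with hCdef
  have hC : IsConePositive K C := fun x hx =>
    hK.smul_mem_interior (hB hx) (inv_pos.2 hμ)
  have hCw : C w = w := by
    rw [hCdef, LinearMap.smul_apply, hBw, smul_smul, inv_mul_cancel₀ hμ.ne', one_smul]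
  have hpow : ∀ (m : ℕ) (v : V), (C ^ m) v = (μ ^ m)⁻¹ • (B ^ m) v := by
    intro m v; rw [hCdef, smul_pow, LinearMap.smul_apply, inv_pow]
  choose L hL hLpos using hK.exists_tendsto_pow hC hw hCw
  have huniq : ∀ {v : V} {r : ℝ}, Tendsto (fun m : ℕ => (C ^ m) v) atTop (𝓝 (r • w)) → L v = r :=
    fun {v r} h => smul_left_injective ℝ hw0 (tendsto_nhds_unique (hL v) h)
  let φ : V →ₗ[ℝ] ℝ :=
    { toFun := L
      map_add' := fun u v => huniq (by
        simpa only [map_add, add_smul] using (hL u).add (hL v))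
      map_smul' := fun r v => huniq (by
        simpa only [map_smul, smul_eq_mul, mul_smul, RingHom.id_apply] using (hL v).const_smul r) }
  have hφC : ∀ v, φ (C v) = φ v := fun v => huniq (by
    have := (hL v).comp (tendsto_add_atTop_nat 1)
    refine this.congr fun m => ?_
    simp only [Function.comp_apply, pow_succ, Module.End.mul_apply])
  have hφw : φ w = 1 := huniq (by
    have : ∀ m : ℕ, (C ^ m) w = w := fun m => by
      induction m with
      | zero => rfl
      | succ m ih => rw [pow_succ, Module.End.mul_apply, hCw, ih]
    simp [this])
  obtain ⟨δ, hδ, hmargin⟩ := hK.exists_sub_norm_smul_mem hC w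
  -- The margin turns φ ≥ 0 on K into a linear lower bound, which gives both strict positivity and
  -- boundedness of the slice φ = 1.
  have hge : ∀ x ∈ K, δ * ‖x‖ ≤ φ x := fun x hx => by
    have : 0 ≤ φ (C x - (δ * ‖x‖) • w) := hLpos _ (hmargin x hx)
    rw [map_sub, hφC, map_smul, hφw, smul_eq_mul, mul_one] at this
    linarith
  refine ⟨μ, φ, w, ⟨hμ, hBw, hφw, fun v => ?_, fun v => ?_⟩, hw, fun x hx h0 => ?_, ?_⟩
  · have := hφC v
    rw [hCdef, LinearMap.smul_apply, map_smul, smul_eq_mul, inv_mul_eq_iff_eq_mul₀ hμ.ne'] at this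
    exact this
  · exact (hL v).congr (hpow · v)
  · exact lt_of_lt_of_le (mul_pos hδ (norm_pos_iff.2 h0)) (hge x hx)
  · have := FiniteDimensional.proper ℝ V
    refine Metric.isCompact_of_isClosed_isBounded ?_ ?_
    · exact hK.isClosed.inter (isClosed_eq φ.continuous_of_finiteDimensional continuous_const)
    · refine (Metric.isBounded_closedBall (x := (0 : V)) (r := δ⁻¹)).subset ?_
      rintro x ⟨hx, hx1⟩
      have := hge x hx
      rw [hx1] at this
      rw [mem_closedBall_zero_iff, inv_eq_one_div, le_div_iff₀ hδ]
      linarith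

end IsProperCone

end Cone

/-! ### Transfer to arbitrary finite-dimensional topological vector spaces -/

section Transport

variable {V W : Type*} [AddCommGroup V] [Module ℝ V] [TopologicalSpace V]
  [AddCommGroup W] [Module ℝ W] [TopologicalSpace W]

theorem IsProperCone.image_equiv {K : Set V} (hK : IsProperCone K) (e : V ≃L[ℝ] W) :
    IsProperCone (e.symm ⁻¹' K) where
  isClosed := hK.isClosed.preimage e.symm.continuous
  add_mem x hx y hy := by simpa using hK.add_mem _ hx _ hy
  smul_mem x hx a ha := by simpa using hK.smul_mem _ hx a ha
  pointed := by
    ext x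
    have : e.symm x ∈ K ∩ -K ↔ e.symm x ∈ ({0} : Set V) := by rw [hK.pointed]
    simpa using this
  solid := by
    rw [← e.symm.coe_toHomeomorph, ← Homeomorph.preimage_interior]
    exact hK.solid.preimage e.symm.surjective

variable [IsTopologicalAddGroup V] [ContinuousSMul ℝ V] [T2Space V] [FiniteDimensional ℝ V]

/-- The Perron–Frobenius theorem. -/
theorem IsProperCone.exists_isPerron [Nontrivial V] {K : Set V} (hK : IsProperCone K)
    {B : V →ₗ[ℝ] V} (hB : IsConePositive K B) : ∃ μ φ w, IsPerron K B μ φ w := by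
  let e : V ≃L[ℝ] EuclideanSpace ℝ (Fin (Module.finrank ℝ V)) := toEuclidean
  have : Nontrivial (EuclideanSpace ℝ (Fin (Module.finrank ℝ V))) :=
    e.symm.surjective.nontrivial
  have hint : interior (e.symm ⁻¹' K) = e.symm ⁻¹' interior K :=
    (e.symm.toHomeomorph.preimage_interior K).symm
  let B' := e.toLinearEquiv.conj B
  have hB'app : ∀ x, B' x = e (B (e.symm x)) := fun x => rfl
  have hB' : IsConePositive (e.symm ⁻¹' K) B' := by
    rintro x ⟨hx, hx0⟩
    rw [hint, Set.mem_preimage, hB'app, e.symm_apply_apply]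
    refine hB ⟨hx, ?_⟩
    simpa using hx0
  obtain ⟨μ, φ, w, h⟩ := (hK.image_equiv e).exists_isPerron_of_normed hB'
  have hpow : ∀ (m : ℕ) x, (B' ^ m) x = e ((B ^ m) (e.symm x)) := by
    intro m
    induction m with
    | zero => simp
    | succ m ih => intro x; rw [pow_succ, Module.End.mul_apply, ih, hB'app, e.symm_apply_apply,
        pow_succ, Module.End.mul_apply]
  refine ⟨μ, φ ∘ₗ e.toLinearMap, e.symm w, ⟨h.pos, ?_, ?_, ?_, ?_⟩, ?_, ?_, ?_⟩
  · have := h.map_eq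
    rw [hB'app] at this
    rw [← map_smul, ← this, e.symm_apply_apply]
  · simpa using h.apply_self
  · intro v
    simpa [hB'app] using h.apply_map (e v)
  · intro v
    have := (e.symm.continuous.tendsto _).comp (h.tendsto (e v))
    simpa [Function.comp_def, hpow] using this
  · have := h.mem_interior
    rwa [hint] at this
  · intro x hx hx0
    exact h.apply_pos (e x) (by simpa using hx) (by simpa using hx0)
  · have := h.isCompact_slice.image e.symm.continuous
    convert this using 1
    ext x
    constructor
    · rintro ⟨hx, hx1⟩
      exact ⟨e x, ⟨by simpa using hx, hx1⟩, by simp⟩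
    · rintro ⟨y, ⟨hy, hy1⟩, rfl⟩
      exact ⟨hy, by simpa using hy1⟩

end Transport

/-! ### Topology of the exterior powers -/

namespace ExtPow

variable (n j : ℕ)

instance instContinuousAdd : ContinuousAdd (ExtPow n j) := IsModuleTopology.toContinuousAdd ℝ _

instance instContinuousSMul : ContinuousSMul ℝ (ExtPow n j) := IsModuleTopology.toContinuousSMul ℝ _

instance instIsTopologicalAddGroup : IsTopologicalAddGroup (ExtPow n j) :=
  IsModuleTopology.topologicalAddGroup ℝ _

instance instT2Space : T2Space (ExtPow n j) := by
  let e : ExtPow n j ≃ₗ[ℝ] (Fin (Module.finrank ℝ (ExtPow n j)) → ℝ) :=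
    (Module.finBasis ℝ (ExtPow n j)).equivFun
  exact T2Space.of_injective_continuous e.injective
    (IsModuleTopology.continuous_of_linearMap e.toLinearMap)

end ExtPow

theorem continuous_bilinear_of_finite {U V W : Type*} [AddCommGroup U] [Module ℝ U]
    [TopologicalSpace U] [IsTopologicalAddGroup U] [ContinuousSMul ℝ U] [T2Space U]
    [FiniteDimensional ℝ U] [AddCommGroup V] [Module ℝ V]
    [TopologicalSpace V] [IsTopologicalAddGroup V] [ContinuousSMul ℝ V] [T2Space V]
    [FiniteDimensional ℝ V] [AddCommGroup W] [Module ℝ W]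
    [TopologicalSpace W] [IsTopologicalAddGroup W] [ContinuousSMul ℝ W] [T2Space W]
    [FiniteDimensional ℝ W]
    (β : U →ₗ[ℝ] V →ₗ[ℝ] W) : Continuous fun p : U × V => β p.1 p.2 := by
  have : IsModuleTopology ℝ U := isModuleTopologyOfFiniteDimensional
  have : IsModuleTopology ℝ V := isModuleTopologyOfFiniteDimensional
  have : IsModuleTopology ℝ W := isModuleTopologyOfFiniteDimensional
  exact IsModuleTopology.continuous_bilinear_of_finite_left β

/-! ### Dominant eigenvalues and decaying vectors -/

section Dominant

variable {V : Type*} [AddCommGroup V] [Module ℝ V] 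

theorem pow_apply_eigenvector {A : V →ₗ[ℝ] V} {v : V} {r : ℝ} (h : A v = r • v) (m : ℕ) :
    (A ^ m) v = r ^ m • v := by
  induction m with
  | zero => simp
  | succ m ih => rw [pow_succ, Module.End.mul_apply, h, map_smul, ih, smul_smul, pow_succ']

variable [TopologicalSpace V]

theorem IsDominant.eq_smul_of_map_eq [T2Space V] {B : V →ₗ[ℝ] V} {μ : ℝ} {φ : V →ₗ[ℝ] ℝ} {w : V}
    (h : IsDominant B μ φ w) {v : V} (hv : B v = μ • v) : v = φ v • w := by
  refine tendsto_nhds_unique ?_ (h.tendsto v)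
  simp_rw [pow_apply_eigenvector hv, smul_smul]
  have : ∀ m : ℕ, (μ ^ m)⁻¹ * μ ^ m = 1 := fun m => inv_mul_cancel₀ (pow_pos h.pos m).ne'
  simp [this]

variable [IsTopologicalAddGroup V] [ContinuousSMul ℝ V]

/-- The vectors whose iterates under `A` grow more slowly than `r ^ m`. -/
def decaySubmodule (A : V →ₗ[ℝ] V) (r : ℝ) : Submodule ℝ V where
  carrier := {z | Tendsto (fun m : ℕ => (r ^ m)⁻¹ • (A ^ m) z) atTop (𝓝 0)}
  add_mem' hx hy := by simpa using Tendsto.add hx hy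
  zero_mem' := by simpa using tendsto_const_nhds
  smul_mem' c z hz := by
    have := Tendsto.const_smul hz c
    simpa [smul_comm c] using this

theorem mem_decaySubmodule {A : V →ₗ[ℝ] V} {r : ℝ} {z : V} : z ∈ decaySubmodule A r ↔
    Tendsto (fun m : ℕ => (r ^ m)⁻¹ • (A ^ m) z) atTop (𝓝 0) := Iff.rfl

theorem map_mem_decaySubmodule {A : V →ₗ[ℝ] V} {r : ℝ} (hr : r ≠ 0) {z : V}
    (hz : z ∈ decaySubmodule A r) : A z ∈ decaySubmodule A r := by
  have h := ((mem_decaySubmodule.1 hz).comp (tendsto_add_atTop_nat 1)).const_smul r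
  rw [smul_zero] at h
  refine h.congr fun m => ?_
  rw [Function.comp_apply, smul_smul, pow_succ (M := V →ₗ[ℝ] V), Module.End.mul_apply, pow_succ]
  congr 1
  field_simp

theorem decaySubmodule_mono {A : V →ₗ[ℝ] V} {r s : ℝ} (hr : 0 < r) (hrs : r < s) :
    decaySubmodule A r ≤ decaySubmodule A s := by
  intro z hz
  have h1 : Tendsto (fun m : ℕ => (r / s) ^ m) atTop (𝓝 0) :=
    tendsto_pow_atTop_nhds_zero_of_lt_one (div_pos hr (hr.trans hrs)).le ((div_lt_one (hr.trans hrs)).2 hrs)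
  have h := h1.smul (mem_decaySubmodule.1 hz)
  rw [smul_zero] at h
  refine h.congr fun m => ?_
  rw [smul_smul, div_pow, div_mul_eq_mul_div, mul_inv_cancel₀ (pow_pos hr m).ne', one_div]

theorem mem_decaySubmodule_of_lt {A : V →ₗ[ℝ] V} {r s : ℝ} (hr : 0 < r) (hrs : r < s) {v : V}
    (hv : A v = r • v) : v ∈ decaySubmodule A s := by
  have h1 : Tendsto (fun m : ℕ => (r / s) ^ m) atTop (𝓝 0) :=
    tendsto_pow_atTop_nhds_zero_of_lt_one (div_pos hr (hr.trans hrs)).le ((div_lt_one (hr.trans hrs)).2 hrs)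
  have h := h1.smul_const v
  rw [zero_smul] at h
  refine h.congr fun m => ?_
  rw [pow_apply_eigenvector hv, smul_smul, div_pow, div_eq_inv_mul]

/-- The orbit of v normalized by r^m is constant, yet decay relative to s ≤ r forces it to tend to
0. -/
theorem eq_zero_of_mem_decaySubmodule [T2Space V] {A : V →ₗ[ℝ] V} {r s : ℝ} (hs : 0 < s)
    (hrs : s ≤ r) {v : V} (hv : A v = r • v) (h : v ∈ decaySubmodule A s) : v = 0 := by
  have hr := hs.trans_le hrs
  have h' : v ∈ decaySubmodule A r := by
    rcases hrs.eq_or_lt with rfl | hlt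
    · exact h
    · exact decaySubmodule_mono hs hlt h
  refine tendsto_nhds_unique ?_ (mem_decaySubmodule.1 h')
  refine tendsto_const_nhds.congr fun m => ?_
  rw [pow_apply_eigenvector hv, smul_smul, inv_mul_cancel₀ (pow_pos hr m).ne', one_smul]

end Dominant

/-! ### Exterior products -/

section Wedge

variable {n j : ℕ}

/-- The exterior product `(z, ω) ↦ z ∧ ω`. -/
noncomputable def wedgeLeft (n j : ℕ) : Euc n →ₗ[ℝ] ExtPow n j →ₗ[ℝ] ExtPow n (j + 1) :=
  exteriorPower.alternatingMapLinearEquiv.toLinearMap ∘ₗ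
    (exteriorPower.ιMulti ℝ (j + 1) (M := Euc n)).curryLeft

theorem wedgeLeft_wedge (z : Euc n) (y : Fin j → Euc n) :
    wedgeLeft n j z (wedge y) = wedge (Fin.cons z y : Fin (j + 1) → Euc n) := by
  simp only [wedgeLeft, wedge, LinearMap.comp_apply, LinearEquiv.coe_coe]
  rw [exteriorPower.alternatingMapLinearEquiv_apply_ιMulti]
  rfl

theorem map_wedge (A : Euc n →ₗ[ℝ] Euc n) (y : Fin j → Euc n) :
    exteriorPower.map j A (wedge y) = wedge fun i => A (y i) :=
  exteriorPower.map_apply_ιMulti A y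

theorem ExtPow.linearMap_ext {W : Type*} [AddCommGroup W] [Module ℝ W]
    {f g : ExtPow n j →ₗ[ℝ] W} (h : ∀ y, f (wedge y) = g (wedge y)) : f = g :=
  exteriorPower.linearMap_ext (AlternatingMap.ext h)

theorem map_wedgeLeft (A : Euc n →ₗ[ℝ] Euc n) (z : Euc n) (ω : ExtPow n j) :
    exteriorPower.map (j + 1) A (wedgeLeft n j z ω) =
      wedgeLeft n j (A z) (exteriorPower.map j A ω) := by
  have : exteriorPower.map (j + 1) A ∘ₗ wedgeLeft n j z =
      wedgeLeft n j (A z) ∘ₗ exteriorPower.map j A := by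
    refine ExtPow.linearMap_ext fun y => ?_
    simp only [LinearMap.comp_apply, wedgeLeft_wedge, map_wedge]
    congr 1
    ext i : 1
    refine Fin.cases ?_ (fun i => ?_) i <;> simp
  exact LinearMap.congr_fun this ω

theorem map_pow_wedgeLeft (A : Euc n →ₗ[ℝ] Euc n) (m : ℕ) (z : Euc n) (ω : ExtPow n j) :
    (exteriorPower.map (j + 1) A ^ m) (wedgeLeft n j z ω) =
      wedgeLeft n j ((A ^ m) z) ((exteriorPower.map j A ^ m) ω) := by
  induction m generalizing z ω with
  | zero => rfl
  | succ m ih => simp only [pow_succ, Module.End.mul_apply, map_wedgeLeft, ih]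

/-- An injection ℝ^j → ℝ^n stays injective on exterior powers, so the standard basis of ℝ^j
suffices, and the determinant detects its product. -/
theorem wedge_ne_zero {x : Fin j → Euc n} (hx : LinearIndependent ℝ x) : wedge x ≠ 0 := by
  let f := Fintype.linearCombination ℝ x
  have hf : Function.Injective f := linearIndependent_iff_injective_fintypeLinearCombination.1 hx
  have h1 : wedge x = exteriorPower.map j f
      (exteriorPower.ιMulti ℝ j fun i => Pi.single i (1 : ℝ)) := by
    rw [exteriorPower.map_apply_ιMulti]
    simp only [wedge]
    congr 1
    ext i : 1
    simp [f, Fintype.linearCombination_apply_single]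
  rw [h1]
  refine fun h0 => ?_
  have h2 := exteriorPower.map_injective_field (n := j) hf
    (h0.trans (map_zero _).symm)
  have h3 := congrArg (exteriorPower.alternatingMapLinearEquiv
    (Matrix.detRowAlternating (R := ℝ) (n := Fin j))) h2
  rw [exteriorPower.alternatingMapLinearEquiv_apply_ιMulti, map_zero] at h3
  have h4 : (Matrix.detRowAlternating (R := ℝ) (n := Fin j)) (fun i => Pi.single i (1 : ℝ)) = 1 := by
    have : (fun i => Pi.single i (1 : ℝ)) = (1 : Matrix (Fin j) (Fin j) ℝ) := by
      ext i k
      simp [Matrix.one_apply, Pi.single_apply, eq_comm]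
    rw [this]
    exact Matrix.det_one
  rw [h4] at h3
  exact one_ne_zero h3

theorem continuous_wedgeLeft : Continuous fun p : Euc n × ExtPow n j => wedgeLeft n j p.1 p.2 :=
  continuous_bilinear_of_finite (wedgeLeft n j)

theorem continuous_wedge : Continuous (wedge : (Fin j → Euc n) → ExtPow n j) := by
  induction j with
  | zero => exact continuous_of_discreteTopology
  | succ j ih =>
    have h1 : Continuous fun y : Fin (j + 1) → Euc n =>
        (y 0, (wedge fun i : Fin j => y i.succ : ExtPow n j)) :=
      (continuous_apply 0).prodMk (ih.comp (by fun_prop))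
    have h2 := (continuous_wedgeLeft (n := n) (j := j)).comp h1
    refine h2.congr fun y => ?_
    rw [Function.comp_apply, wedgeLeft_wedge]
    exact congrArg wedge (Fin.cons_self_tail y)

end Wedge

/-- By a swap, f vanishes as soon as any slot lies in U; the entries are then exchanged one by one.
In effect f factors through the quotient by U. -/
theorem AlternatingMap.eq_of_sub_mem {M N : Type*} [AddCommGroup M] [Module ℝ M]
    [AddCommGroup N] [Module ℝ N] {j : ℕ} (f : M [⋀^Fin (j + 1)]→ₗ[ℝ] N) (U : Submodule ℝ M)
    (h : ∀ u ∈ U, ∀ y : Fin j → M, f (Fin.cons u y : Fin (j + 1) → M) = 0)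
    {x y : Fin (j + 1) → M} (hxy : ∀ i, x i - y i ∈ U) : f x = f y := by
  have h' : ∀ (z : Fin (j + 1) → M) (i : Fin (j + 1)), z i ∈ U → f z = 0 := by
    intro z i hi
    rcases eq_or_ne i 0 with rfl | hi0
    · rw [← Fin.cons_self_tail z]
      exact h _ hi _
    · rw [← neg_eq_zero, ← f.map_swap z hi0.symm, ← Fin.cons_self_tail (z ∘ _)]
      exact h _ (by simpa using hi) _
  have key : ∀ s : Finset (Fin (j + 1)), f (s.piecewise y x) = f x := by
    intro s
    induction s using Finset.induction_on with
    | empty => simp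
    | insert i s hi ih =>
      rw [← ih, Finset.piecewise_insert, ← sub_eq_zero]
      have : s.piecewise y x = Function.update (s.piecewise y x) i (x i) := by
        rw [eq_comm, Function.update_eq_self_iff]
        simp [hi]
      conv_lhs => rw [this]
      rw [Function.update_idem, ← f.map_update_sub]
      refine h' _ i ?_
      rw [Function.update_self, ← neg_sub]
      exact U.neg_mem (hxy i)
  simpa using (key Finset.univ).symm

/-! ### Splitting off one eigenvector -/

section Step

variable {n j : ℕ} {A : Euc n →ₗ[ℝ] Euc n} {μ μ' : ℝ} {φ : ExtPow n j →ₗ[ℝ] ℝ} {w : ExtPow n j}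
  {φ' : ExtPow n (j + 1) →ₗ[ℝ] ℝ} {w' : ExtPow n (j + 1)}

/-- The dominant functional on `⋀^(j+1)` annihilates `z ∧ ω` if `z` decays relatively to the
quotient of the dominant eigenvalues. -/
theorem IsDominant.apply_wedgeLeft_eq_zero (h : IsDominant (exteriorPower.map j A) μ φ w)
    (h' : IsDominant (exteriorPower.map (j + 1) A) μ' φ' w') {z : Euc n}
    (hz : z ∈ decaySubmodule A (μ' / μ)) (ω : ExtPow n j) : φ' (wedgeLeft n j z ω) = 0 := by
  have hφ' : ∀ (m : ℕ) v, φ' ((exteriorPower.map (j + 1) A ^ m) v) = μ' ^ m * φ' v := by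
    intro m
    induction m with
    | zero => simp
    | succ m ih => intro v; rw [pow_succ, Module.End.mul_apply, ih, h'.apply_map]; ring
  have hc : Continuous φ' := LinearMap.continuous_of_finiteDimensional φ'
  -- Normalizing z by (μ'/μ)^m and ω by μ^m normalizes z ∧ ω by μ'^m, so φ' is constant along the
  -- sequence while its argument tends to 0.
  have h1 := ((hc.comp continuous_wedgeLeft).tendsto (0, φ ω • w)).comp
    ((mem_decaySubmodule.1 hz).prodMk_nhds (h.tendsto ω))
  simp only [Function.comp_def, map_zero, LinearMap.zero_apply] at h1
  refine tendsto_nhds_unique (tendsto_const_nhds.congr fun m => ?_) h1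
  have hμ := pow_pos h.pos m
  have hμ' := pow_pos h'.pos m
  simp only [map_smul, LinearMap.smul_apply, ← map_pow_wedgeLeft, hφ', smul_eq_mul, div_pow]
  field_simp

theorem wedgeLeft_wedge_eq_zero {x : Fin j → Euc n} (hx : LinearIndependent ℝ x) {u : Euc n}
    (h : wedgeLeft n j u (wedge x) = 0) : u ∈ Submodule.span ℝ (Set.range x) := by
  by_contra hu
  rw [wedgeLeft_wedge] at h
  exact wedge_ne_zero (linearIndependent_finCons.2 ⟨hx, hu⟩) h

/-- If `V = span x ⊕ U` with `U` invariant and `x₁ ∧ … ∧ xⱼ` is dominant in `⋀^j`, then `U`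
splits into an eigenvector and vectors that decay. -/
theorem IsDominant.exists_eigenvector_step (h : IsDominant (exteriorPower.map j A) μ φ w)
    (h' : IsDominant (exteriorPower.map (j + 1) A) μ' φ' w') {x : Fin j → Euc n}
    (hx : exteriorPower.map j A (wedge x) = μ • wedge x) (hli : LinearIndependent ℝ x)
    {U : Submodule ℝ (Euc n)} (hU : ∀ u ∈ U, A u ∈ U)
    (hdis : ∀ u ∈ U, u ∈ Submodule.span ℝ (Set.range x) → u = 0)
    (hsup : Submodule.span ℝ (Set.range x) ⊔ U = ⊤) :
    ∃ v ∈ U, v ≠ 0 ∧ A v = (μ' / μ) • v ∧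
      U ≤ Submodule.span ℝ {v} ⊔ decaySubmodule A (μ' / μ) := by
  have hμ := h.pos
  have hμ' := h'.pos
  have hquot : 0 < μ' / μ := div_pos hμ' hμ
  let T : Euc n →ₗ[ℝ] ExtPow n (j + 1) := (wedgeLeft n j).flip (wedge x)
  have hT : ∀ u, T u = wedgeLeft n j u (wedge x) := fun u => rfl
  have hTA : ∀ (m : ℕ) u, (exteriorPower.map (j + 1) A ^ m) (T u) = μ ^ m • T ((A ^ m) u) := by
    intro m u
    rw [hT, map_pow_wedgeLeft, pow_apply_eigenvector hx, map_smul, hT]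
  let ψ : Euc n →ₗ[ℝ] ℝ := φ' ∘ₗ T
  have hψA : ∀ u, ψ (A u) = (μ' / μ) * ψ u := by
    intro u
    have h1 := congrArg φ' (hTA 1 u)
    simp only [pow_one, h'.apply_map, map_smul, smul_eq_mul] at h1
    change φ' (T (A u)) = (μ' / μ) * φ' (T u)
    field_simp
    linarith
  let W := U ⊓ LinearMap.ker ψ
  have hAU : ∀ (m : ℕ), ∀ u ∈ U, (A ^ m) u ∈ U := by
    intro m
    induction m with
    | zero => exact fun u hu => hu
    | succ m ih => intro u hu; rw [pow_succ, Module.End.mul_apply]; exact ih _ (hU u hu)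
  -- Wedging with x₁ ∧ … ∧ xⱼ is injective on U; its left inverse carries the decay in the kernel of
  -- φ' back to U.
  have hW : W ≤ decaySubmodule A (μ' / μ) := by
    rintro u ⟨hu, hu0⟩
    have hinj : Function.Injective (T ∘ₗ U.subtype) := by
      rw [← LinearMap.ker_eq_bot, LinearMap.ker_eq_bot']
      intro u hu
      exact Subtype.ext (hdis _ u.2 (wedgeLeft_wedge_eq_zero hli hu))
    obtain ⟨g, hg⟩ := LinearMap.exists_leftInverse_of_injective _ (LinearMap.ker_eq_bot.2 hinj)
    have hgU : ∀ u ∈ U, (g (T u) : Euc n) = u := fun u hu => by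
      have := LinearMap.congr_fun hg ⟨u, hu⟩
      exact congrArg Subtype.val this
    have hc : Continuous (U.subtype ∘ₗ g) := LinearMap.continuous_of_finiteDimensional _
    have h1 := h'.tendsto (T u)
    have h2 : φ' (T u) = 0 := hu0
    rw [h2, zero_smul] at h1
    have h3 := (hc.tendsto 0).comp h1
    rw [map_zero] at h3
    refine h3.congr fun m => ?_
    simp only [Function.comp_apply, hTA, map_smul, LinearMap.comp_apply, Submodule.subtype_apply,
      hgU _ (hAU m u hu), smul_smul, div_pow]
    congr 1
    have := pow_pos hμ m
    have := pow_pos hμ' m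
    field_simp
  -- Otherwise all of U decays, so φ' ignores U in every slot and is determined by j + 1 vectors of
  -- the j-dimensional span of x, hence φ' = 0.
  obtain ⟨u, hu, hψu⟩ : ∃ u ∈ U, ψ u ≠ 0 := by
    by_contra! hcon
    have hUd : U ≤ decaySubmodule A (μ' / μ) := fun u hu => hW ⟨hu, hcon u hu⟩
    let f := φ'.compAlternatingMap (exteriorPower.ιMulti ℝ (j + 1) (M := Euc n))
    have hf : ∀ y, φ' (wedge y) = f y := fun y => rfl
    have hzero : φ' = 0 := by
      refine ExtPow.linearMap_ext fun y => ?_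
      have hy : ∀ i, ∃ s ∈ Submodule.span ℝ (Set.range x), y i - s ∈ U := by
        intro i
        have : y i ∈ Submodule.span ℝ (Set.range x) ⊔ U := by rw [hsup]; trivial
        obtain ⟨s, hs, t, ht, hst⟩ := Submodule.mem_sup.1 this
        exact ⟨s, hs, by rwa [← hst, add_sub_cancel_left]⟩
      choose s hs hsU using hy
      rw [hf, f.eq_of_sub_mem U ?_ hsU, LinearMap.zero_apply]
      · refine f.map_linearDependent s fun hs' => ?_
        have h1 : LinearIndependent ℝ (fun i => (⟨s i, hs i⟩ : Submodule.span ℝ (Set.range x))) :=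
          LinearIndependent.of_comp (Submodule.subtype _) hs'
        have h2 := h1.fintype_card_le_finrank
        have h3 := finrank_range_le_card (R := ℝ) x
        rw [Set.finrank] at h3
        simp only [Fintype.card_fin] at h2 h3
        omega
      · intro u hu y
        rw [← hf, ← wedgeLeft_wedge]
        exact h.apply_wedgeLeft_eq_zero h' (hUd hu) _
    have := h'.apply_self
    rw [hzero] at this
    simp at this
  -- S maps U into W and is injective on W by decay, hence bijective there. Solving S v = S u in W
  -- makes u - v an eigenvector on which ψ does not vanish.
  let S : Euc n →ₗ[ℝ] Euc n := A - (μ' / μ) • LinearMap.id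
  have hS : ∀ v, S v = A v - (μ' / μ) • v := fun v => rfl
  have hAW : ∀ v ∈ W, S v ∈ W := by
    rintro v ⟨hv, -⟩
    refine ⟨U.sub_mem (hU v hv) (U.smul_mem _ hv), ?_⟩
    rw [SetLike.mem_coe, LinearMap.mem_ker, hS, map_sub, hψA, map_smul, smul_eq_mul, sub_self]
  let R := S.restrict hAW
  have hRinj : Function.Injective R := by
    rw [← LinearMap.ker_eq_bot, LinearMap.ker_eq_bot']
    intro v hv
    have h1 : A v - (μ' / μ) • (v : Euc n) = 0 := congrArg Subtype.val hv
    exact Subtype.ext (eq_zero_of_mem_decaySubmodule hquot le_rfl (sub_eq_zero.1 h1) (hW v.2))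
  have huW : S u ∈ W := by
    refine ⟨U.sub_mem (hU u hu) (U.smul_mem _ hu), ?_⟩
    rw [SetLike.mem_coe, LinearMap.mem_ker, hS, map_sub, hψA, map_smul, smul_eq_mul, sub_self]
  obtain ⟨v, hv⟩ := LinearMap.injective_iff_surjective.1 hRinj ⟨_, huW⟩
  have hv' : A v - (μ' / μ) • (v : Euc n) = A u - (μ' / μ) • u := congrArg Subtype.val hv
  have hψv : ψ v = 0 := v.2.2
  have hψ : ψ (u - v) ≠ 0 := by rwa [map_sub, hψv, sub_zero]
  refine ⟨u - v, U.sub_mem hu v.2.1, ?_, ?_, ?_⟩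
  · intro h0
    rw [h0, map_zero] at hψ
    exact hψ rfl
  · rw [map_sub, smul_sub, sub_eq_sub_iff_sub_eq_sub, ← hv']
  · intro z hz
    refine Submodule.mem_sup.2 ⟨(ψ z / ψ (u - v)) • (u - v),
      Submodule.smul_mem _ _ (Submodule.mem_span_singleton_self _),
      z - (ψ z / ψ (u - v)) • (u - v), hW ⟨?_, ?_⟩, by abel⟩
    · exact U.sub_mem hz (U.smul_mem _ (U.sub_mem hu v.2.1))
    · rw [SetLike.mem_coe, LinearMap.mem_ker, map_sub, map_smul, smul_eq_mul, div_mul_cancel₀ _ hψ, sub_self]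

end Step

/-! ### The full system of eigenvectors -/

section Induction

variable {n : ℕ} {A : Euc n →ₗ[ℝ] Euc n}

theorem map_wedge_eigenvectors {j : ℕ} {x : Fin j → Euc n} {r : Fin j → ℝ}
    (h : ∀ i, A (x i) = r i • x i) :
    exteriorPower.map j A (wedge x) = (∏ i, r i) • wedge x := by
  rw [map_wedge]
  simp only [h]
  exact (exteriorPower.ιMulti ℝ j).toMultilinearMap.map_smul_univ r x

/-- The quotients of consecutive terms. -/
noncomputable def quotientSeq (μ : ℕ → ℝ) (i : ℕ) : ℝ := μ i / μ (i - 1)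

theorem prod_quotientSeq {μ : ℕ → ℝ} (hμ0 : μ 0 = 1) {j : ℕ} (hμ : ∀ i ≤ j, 0 < μ i) :
    ∏ i : Fin j, quotientSeq μ (i + 1) = μ j := by
  induction j with
  | zero => simp [hμ0]
  | succ j ih =>
    rw [Fin.prod_univ_castSucc]
    simp only [Fin.val_castSucc, Fin.val_last]
    rw [ih fun i hi => hμ i (by omega), quotientSeq, add_tsub_cancel_right]
    exact mul_div_cancel₀ _ (hμ j (by omega)).ne'

/-- Normalized by rᵢ^m, the orbit of u has the constant i-th coordinate cᵢ, which decay sends to 0.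
-/
theorem eq_zero_of_mem_span_of_mem_decaySubmodule {j : ℕ} {x : Fin j → Euc n} {r : Fin j → ℝ}
    (hr : ∀ i, 0 < r i) (h : ∀ i, A (x i) = r i • x i) (hli : LinearIndependent ℝ x) {u : Euc n}
    (hu : u ∈ Submodule.span ℝ (Set.range x)) (hd : ∀ i, u ∈ decaySubmodule A (r i)) : u = 0 := by
  have hf := linearIndependent_iff_injective_fintypeLinearCombination.1 hli
  obtain ⟨g, hg⟩ := LinearMap.exists_leftInverse_of_injective _ (LinearMap.ker_eq_bot.2 hf)
  obtain ⟨c, rfl⟩ := (Submodule.mem_span_range_iff_exists_fun ℝ).1 hu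
  refine Finset.sum_eq_zero fun i _ => ?_
  have hc : Continuous (LinearMap.proj i ∘ₗ g : Euc n →ₗ[ℝ] ℝ) :=
    LinearMap.continuous_of_finiteDimensional _
  have h1 := (hc.tendsto 0).comp (mem_decaySubmodule.1 (hd i))
  rw [map_zero] at h1
  have hgc : ∀ c : Fin j → ℝ, g (∑ i, c i • x i) = c := fun c => LinearMap.congr_fun hg c
  have h2 : c i = 0 := by
    refine tendsto_nhds_unique (tendsto_const_nhds.congr fun m => ?_) h1
    have h3 : (A ^ m) (∑ k, c k • x k) = ∑ k, (c k * r k ^ m) • x k := by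
      simp only [map_sum, map_smul, pow_apply_eigenvector (h _), smul_smul]
    rw [Function.comp_apply, h3, map_smul, LinearMap.comp_apply, hgc, LinearMap.proj_apply,
      smul_eq_mul]
    have := (pow_pos (hr i) m).ne'
    field_simp
  rw [h2, zero_smul]

theorem eigenvectors_linearIndependent_of_strictAnti {j : ℕ} {x : Fin j → Euc n} {r : Fin j → ℝ}
    (hr : StrictAnti r) (h : ∀ i, A (x i) = r i • x i) (h0 : ∀ i, x i ≠ 0) :
    LinearIndependent ℝ x :=
  Module.End.eigenvectors_linearIndependent' A r hr.injective x fun i =>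
    Module.End.hasEigenvector_iff.2 ⟨Module.End.mem_eigenspace_iff.2 (h i), h0 i⟩

theorem exists_eigenvectors {μ : ℕ → ℝ} {φ : ∀ j, ExtPow n j →ₗ[ℝ] ℝ} {w : ∀ j, ExtPow n j}
    (hP : ∀ j ≤ n, IsDominant (exteriorPower.map j A) (μ j) (φ j) (w j)) (hμ0 : μ 0 = 1) :
    ∃ x : Fin n → Euc n, (∀ i, x i ≠ 0) ∧ (∀ i, A (x i) = quotientSeq μ (i + 1) • x i) ∧
      StrictAnti fun i : Fin n => quotientSeq μ (i + 1) := by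
  have hpos : ∀ i, i + 1 ≤ n → 0 < quotientSeq μ (i + 1) := fun i hi =>
    div_pos (hP _ hi).pos (hP _ (by omega)).pos
  suffices H : ∀ j ≤ n, ∃ (x : Fin j → Euc n) (U : Submodule ℝ (Euc n)), (∀ i, x i ≠ 0) ∧
      (∀ i, A (x i) = quotientSeq μ (i + 1) • x i) ∧
      (StrictAnti fun i : Fin j => quotientSeq μ (i + 1)) ∧ (∀ u ∈ U, A u ∈ U) ∧
      (∀ i : Fin j, U ≤ decaySubmodule A (quotientSeq μ (i + 1))) ∧
      Submodule.span ℝ (Set.range x) ⊔ U = ⊤ by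
    obtain ⟨x, _, h0, h1, h2, _⟩ := H n le_rfl
    exact ⟨x, h0, h1, h2⟩
  intro j hj
  induction j with
  | zero =>
    exact ⟨Fin.elim0, ⊤, fun i => i.elim0, fun i => i.elim0, fun i => i.elim0, fun _ _ => trivial,
      fun i => i.elim0, by simp⟩
  | succ j ih =>
    obtain ⟨x, U, h0, hx, hanti, hU, hdec, hsup⟩ := ih (by omega)
    have hli := eigenvectors_linearIndependent_of_strictAnti hanti hx h0
    have hwx : exteriorPower.map j A (wedge x) = μ j • wedge x := by
      rw [map_wedge_eigenvectors hx, prod_quotientSeq hμ0 fun i hi => (hP i (by omega)).pos]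
    obtain ⟨v, hvU, hv0, hv, hle⟩ := (hP j (by omega)).exists_eigenvector_step (hP (j + 1) hj) hwx
      hli hU (fun u hu hu' => eq_zero_of_mem_span_of_mem_decaySubmodule
        (fun i : Fin j => hpos i (by omega)) hx hli hu' fun i => hdec i hu) hsup
    have hq : μ (j + 1) / μ j = quotientSeq μ (j + 1) := rfl
    rw [hq] at hv hle
    have hqpos := hpos j hj
    have hlt : ∀ i : Fin j, quotientSeq μ (j + 1) < quotientSeq μ (i + 1) := by
      intro i
      by_contra! hge
      exact hv0 (eq_zero_of_mem_decaySubmodule (hpos i (by omega)) hge hv (hdec i hvU))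
    -- The next complement is the whole decay space of the new eigenvalue: it is invariant, and by
    -- strict ordering it also decays relative to all earlier ones.
    refine ⟨Fin.snoc x v, decaySubmodule A (quotientSeq μ (j + 1)), ?_, ?_, ?_,
      fun u hu => map_mem_decaySubmodule hqpos.ne' hu, ?_, ?_⟩
    · intro i
      refine Fin.lastCases ?_ (fun i => ?_) i <;> simp [hv0, h0]
    · intro i
      refine Fin.lastCases ?_ (fun i => ?_) i <;> simp [hv, hx]
    · intro i k hik
      induction k using Fin.lastCases with
      | last =>
        induction i using Fin.lastCases with
        | last => exact absurd hik (lt_irrefl _)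
        | cast i => simpa using hlt i
      | cast k =>
        induction i using Fin.lastCases with
        | last => exact absurd hik (by simp [Fin.lt_def])
        | cast i => simpa using hanti (Fin.castSucc_lt_castSucc_iff.1 hik)
    · intro i
      refine Fin.lastCases ?_ (fun i => ?_) i
      · simp
      · simpa using decaySubmodule_mono hqpos (hlt i)
    · rw [eq_top_iff, ← hsup, Fin.range_snoc, Set.insert_eq, Submodule.span_union]
      refine sup_le (le_sup_of_le_left le_sup_right) (hle.trans ?_)
      exact sup_le (le_sup_of_le_left le_sup_left) le_sup_right

end Induction

/-! ### Characteristic roots and spectral radius -/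

section Spectrum

variable {n : ℕ} {A : Euc n →ₗ[ℝ] Euc n} {lam : ℕ → ℝ}

/-- The n distinct eigenvalues already fill a multiset of roots of a polynomial of degree n. -/
theorem roots_charpoly_map_eq (hinj : Set.InjOn lam (Finset.Icc 1 n))
    (h : ∀ i ∈ Finset.Icc 1 n, Module.End.HasEigenvalue A (lam i)) :
    (A.charpoly.map (algebraMap ℝ ℂ)).roots =
      (Finset.Icc 1 n).val.map (fun i => (lam i : ℂ)) := by
  have hmonic : (A.charpoly.map (algebraMap ℝ ℂ)).Monic := A.charpoly_monic.map _
  symm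
  refine Multiset.eq_of_le_of_card_le ?_ ?_
  · rw [Multiset.le_iff_subset]
    · intro z hz
      obtain ⟨i, hi, rfl⟩ := Multiset.mem_map.1 hz
      rw [Polynomial.mem_roots hmonic.ne_zero]
      exact ((Module.End.hasEigenvalue_iff_isRoot_charpoly A _).1 (h i hi)).map
    · refine (Multiset.nodup_map_iff_inj_on (Finset.Icc 1 n).nodup).2 fun i hi k hk hik => ?_
      exact hinj hi hk (Complex.ofReal_injective hik)
  · refine (Polynomial.card_roots' _).trans ?_
    rw [Polynomial.natDegree_map, LinearMap.charpoly_natDegree, finrank_euclideanSpace_fin]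
    simp

theorem spectralRadius_baseChange_eq (hn : 1 ≤ n)
    (hanti : ∀ i j : ℕ, 1 ≤ i → i < j → j ≤ n → lam j < lam i)
    (hpos : ∀ i ∈ Finset.Icc 1 n, 0 < lam i)
    (h : (A.charpoly.map (algebraMap ℝ ℂ)).roots =
      (Finset.Icc 1 n).val.map (fun i => (lam i : ℂ))) :
    spectralRadius ℂ (A.baseChange ℂ : Module.End ℂ (TensorProduct ℝ ℂ (Euc n))) =
      ENNReal.ofReal (lam 1) := by
  have hmonic : (A.charpoly.map (algebraMap ℝ ℂ)).Monic := A.charpoly_monic.map _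
  have hspec : ∀ k : ℂ,
      k ∈ spectrum ℂ (A.baseChange ℂ : Module.End ℂ (TensorProduct ℝ ℂ (Euc n))) ↔
        ∃ i ∈ Finset.Icc 1 n, (lam i : ℂ) = k := by
    intro k
    rw [← Module.End.hasEigenvalue_iff_mem_spectrum, Module.End.hasEigenvalue_iff_isRoot_charpoly,
      LinearMap.charpoly_baseChange, ← Polynomial.mem_roots hmonic.ne_zero, h, Multiset.mem_map]
    rfl
  have hnorm : ∀ i ∈ Finset.Icc 1 n, ((‖(lam i : ℂ)‖₊ : NNReal) : ENNReal) =
      ENNReal.ofReal (lam i) := by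
    intro i hi
    rw [← enorm_eq_nnnorm, ← ofReal_norm, Complex.norm_real,
      Real.norm_of_nonneg (hpos i hi).le]
  have h1 : 1 ∈ Finset.Icc 1 n := Finset.mem_Icc.2 ⟨le_rfl, hn⟩
  refine le_antisymm ?_ ?_
  · refine iSup₂_le fun k hk => ?_
    obtain ⟨i, hi, rfl⟩ := (hspec k).1 hk
    rw [hnorm i hi]
    refine ENNReal.ofReal_le_ofReal ?_
    obtain ⟨hi1, hin⟩ := Finset.mem_Icc.1 hi
    rcases hi1.eq_or_lt with rfl | hlt
    · exact le_rfl
    · exact (hanti 1 i le_rfl hlt hin).le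
  · rw [← hnorm 1 h1]
    exact le_iSup₂ (f := fun (k : ℂ) (_ : k ∈ spectrum ℂ (A.baseChange ℂ :
      Module.End ℂ (TensorProduct ℝ ℂ (Euc n)))) => ((‖k‖₊ : NNReal) : ENNReal)) (lam 1 : ℂ)
      ((hspec _).2 ⟨1, h1, rfl⟩)

end Spectrum

/-! ### Separation from divisors of cone elements -/

section Separation

variable {n j : ℕ}

/-- The map `u ↦ ⟪v, v⟫ u - ⟪v, u⟫ v`, a multiple of the projection along `v`. -/
noncomputable def scaledProj (v : Euc n) : Euc n →ₗ[ℝ] Euc n :=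
  inner ℝ v v • LinearMap.id - (innerₛₗ ℝ v).smulRight v

theorem scaledProj_apply (v u : Euc n) :
    scaledProj v u = inner ℝ v v • u - inner ℝ v u • v := rfl

theorem map_scaledProj_wedge (v : Euc n) (y : Fin j → Euc n) :
    exteriorPower.map (j + 1) (scaledProj v) (wedge (Fin.cons v y : Fin (j + 1) → Euc n)) = 0 := by
  rw [map_wedge]
  refine (exteriorPower.ιMulti ℝ (j + 1)).map_coord_zero 0 ?_
  simp [scaledProj_apply]

/-- Modulo v, `scaledProj v` is multiplication by ⟪v, v⟫, and φ ignores multiples of v in every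
slot. -/
theorem apply_map_scaledProj {φ : ExtPow n (j + 1) →ₗ[ℝ] ℝ} {v : Euc n}
    (hv : ∀ ω, φ (wedgeLeft n j v ω) = 0) (ω : ExtPow n (j + 1)) :
    φ (exteriorPower.map (j + 1) (scaledProj v) ω) = inner ℝ v v ^ (j + 1) * φ ω := by
  let f := φ.compAlternatingMap (exteriorPower.ιMulti ℝ (j + 1) (M := Euc n))
  have hf : ∀ y, φ (wedge y) = f y := fun y => rfl
  have h : φ ∘ₗ exteriorPower.map (j + 1) (scaledProj v) = (inner ℝ v v : ℝ) ^ (j + 1) • φ := by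
    refine ExtPow.linearMap_ext fun y => ?_
    rw [LinearMap.comp_apply, map_wedge, LinearMap.smul_apply, hf, hf,
      f.eq_of_sub_mem (Submodule.span ℝ {v}) (y := fun i => inner ℝ v v • y i)]
    · have := f.toMultilinearMap.map_smul_univ (fun _ => (inner ℝ v v : ℝ)) y
      simpa using this
    · intro u hu z
      obtain ⟨c, rfl⟩ := Submodule.mem_span_singleton.1 hu
      rw [← hf, ← wedgeLeft_wedge, map_smul, LinearMap.smul_apply, map_smul, hv, smul_zero]
    · intro i
      rw [scaledProj_apply, sub_sub_cancel_left]
      exact Submodule.neg_mem _ (Submodule.smul_mem _ _ (Submodule.mem_span_singleton_self v))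
  exact LinearMap.congr_fun h ω

theorem continuous_map_scaledProj : Continuous fun p : Euc n × ExtPow n j =>
    exteriorPower.map j (scaledProj p.1) p.2 := by
  have h1 : ∀ ω : ExtPow n j, Continuous fun v : Euc n => exteriorPower.map j (scaledProj v) ω := by
    intro ω
    have hω : ω ∈ Submodule.span ℝ (Set.range (exteriorPower.ιMulti ℝ j (M := Euc n))) := by
      rw [exteriorPower.ιMulti_span]; trivial
    induction hω using Submodule.span_induction with
    | mem ω h =>
      obtain ⟨y, rfl⟩ := h
      have : ∀ v, exteriorPower.map j (scaledProj v) (exteriorPower.ιMulti ℝ j y) =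
        wedge fun i => scaledProj v (y i) := fun v => map_wedge _ _
      simp only [this, scaledProj_apply]
      exact continuous_wedge.comp (by fun_prop)
    | zero => simpa using continuous_const
    | add x y _ _ hx hy => exact (hx.add hy).congr fun v => (map_add _ x y).symm
    | smul c x _ hx => exact (hx.const_smul c).congr fun v => (map_smul _ c x).symm
  let b := Module.finBasis ℝ (ExtPow n j)
  have h2 : ∀ p : Euc n × ExtPow n j, exteriorPower.map j (scaledProj p.1) p.2 =
      ∑ k, b.coord k p.2 • exteriorPower.map j (scaledProj p.1) (b k) := by
    intro p
    conv_lhs => rw [← b.sum_repr p.2]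
    simp only [map_sum, map_smul, Module.Basis.coord_apply]
  simp only [h2]
  refine continuous_finsetSum _ fun k _ => ?_
  have h3 : Continuous (b.coord k) := LinearMap.continuous_of_finiteDimensional _
  exact (h3.comp continuous_snd).smul ((h1 (b k)).comp continuous_fst)

theorem interior_neg_set {V : Type*} [AddCommGroup V] [TopologicalSpace V]
    [IsTopologicalAddGroup V] (s : Set V) : interior (-s) = -interior s :=
  ((Homeomorph.neg V).preimage_interior s).symm

/-- Were 0 interior, K would contain some -t w with t > 0, where φ is negative. -/
theorem IsPerron.ne_zero_of_mem_interior {V : Type*} [AddCommGroup V] [Module ℝ V]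
    [TopologicalSpace V] [IsTopologicalAddGroup V] [ContinuousSMul ℝ V] {K : Set V}
    {B : V →ₗ[ℝ] V} {μ : ℝ} {φ : V →ₗ[ℝ] ℝ} {w : V} (h : IsPerron K B μ φ w) {x : V}
    (hx : x ∈ interior K) : x ≠ 0 := by
  rintro rfl
  obtain ⟨t, ht, hK⟩ := IsProperCone.exists_sub_smul_mem hx w
  have hw : w ≠ 0 := fun h0 => by simpa [h0] using h.apply_self
  have := h.apply_pos _ hK (by simp [ht.ne', hw])
  simp [h.apply_self] at this
  linarith

/-- Vectors annihilated by the positive functional of `K` stay away from all vectors that divide a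
nonzero element of `K ∪ -K`. -/
theorem notMem_closure_of_apply_wedgeLeft_eq_zero {K : Set (ExtPow n (j + 1))}
    {B : ExtPow n (j + 1) →ₗ[ℝ] ExtPow n (j + 1)} {μ : ℝ} {φ : ExtPow n (j + 1) →ₗ[ℝ] ℝ}
    {w : ExtPow n (j + 1)} (hK : IsProperCone K) (h : IsPerron K B μ φ w) {v : Euc n}
    (hv : ∀ ω, φ (wedgeLeft n j v ω) = 0) (hv0 : v ≠ 0) :
    v ∉ closure {x : Euc n | ∃ y : Fin j → Euc n,
      wedge (Fin.cons x y : Fin (j + 1) → Euc n) ≠ 0 ∧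
      wedge (Fin.cons x y : Fin (j + 1) → Euc n) ∈ K ∪ -K} := by
  let S : Set (ExtPow n (j + 1)) := {ω ∈ K | φ ω = 1}
  have : CompactSpace S := isCompact_iff_compactSpace.1 h.isCompact_slice
  have hG₀ : IsClosed {q : Euc n × ExtPow n (j + 1) |
      exteriorPower.map (j + 1) (scaledProj q.1) q.2 = 0} :=
    isClosed_eq continuous_map_scaledProj continuous_const
  have hc : Continuous fun p : Euc n × S => (p.1, (p.2 : ExtPow n (j + 1))) :=
    continuous_fst.prodMk (continuous_subtype_val.comp continuous_snd)
  let G : Set (Euc n × S) := (fun p => (p.1, (p.2 : ExtPow n (j + 1)))) ⁻¹'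
    {q | exteriorPower.map (j + 1) (scaledProj q.1) q.2 = 0}
  have hG : IsClosed G := hG₀.preimage hc
  -- Having a form in the slice φ = 1 killed by `scaledProj x` is a closed condition on x, because
  -- the slice is compact. Every divisor of a nonzero element of ±K satisfies it; v does not, as φ
  -- of the image is ⟪v, v⟫^(j+1). Scaling the projection avoids division by ⟪x, x⟫ and keeps it
  -- continuous at 0.
  have hF : IsClosed (Prod.fst '' G) := isClosedMap_fst_of_compactSpace _ hG
  intro hmem
  have hvF : v ∈ Prod.fst '' G := by
    refine closure_minimal ?_ hF hmem
    rintro x ⟨y, hne, hxy⟩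
    have hcase : ∀ ω ∈ K, ω ≠ 0 → exteriorPower.map (j + 1) (scaledProj x) ω = 0 →
        x ∈ Prod.fst '' G := by
      intro ω hω hω0 hz
      have hpos := h.apply_pos ω hω hω0
      refine ⟨⟨x, ⟨(φ ω)⁻¹ • ω, hK.smul_mem _ hω _ (inv_nonneg.2 hpos.le), ?_⟩⟩, ?_, rfl⟩
      · rw [map_smul, smul_eq_mul, inv_mul_cancel₀ hpos.ne']
      · change exteriorPower.map (j + 1) (scaledProj x) ((φ ω)⁻¹ • ω) = 0
        rw [map_smul, hz, smul_zero]
    rcases hxy with hxy | hxy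
    · exact hcase _ hxy hne (map_scaledProj_wedge x y)
    · exact hcase _ hxy (neg_ne_zero.2 hne) (by rw [map_neg, map_scaledProj_wedge, neg_zero])
  obtain ⟨⟨x, ⟨ω, hω, hω1⟩⟩, hz, hx⟩ := hvF
  have h1 := apply_map_scaledProj hv ω
  have h2 : exteriorPower.map (j + 1) (scaledProj v) ω = 0 := by rw [← hx]; exact hz
  rw [h2, map_zero, hω1, mul_one] at h1
  have h3 : (inner ℝ v v : ℝ) ≠ 0 := inner_self_ne_zero.2 hv0
  exact pow_ne_zero _ h3 h1.symm

end Separation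

/-! ### Interior and exterior points of the sets T -/

section TSet

variable {n : ℕ} {K : ∀ j : ℕ, Set (ExtPow n j)} {A : Euc n →ₗ[ℝ] Euc n}

theorem TSet_zero : TSet K 0 = {0} := by rw [TSet]

theorem TSet_one : TSet K 1 = firstCone K ∪ -firstCone K := by rw [TSet]

theorem TSet_add_two (j : ℕ) : TSet K (j + 2) =
    closure {x | ∃ y : Fin (j + 1) → Euc n, (∀ i : Fin (j + 1), y i ∈ TSet K (i + 1)) ∧
      wedge (Fin.cons x y : Fin (j + 2) → Euc n) ∈
        interior (K (j + 2)) ∪ interior (-K (j + 2))} := by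
  rw [TSet]

theorem wedge_singleton_eq (x : Euc n) (y : Fin 0 → Euc n) :
    (wedge ![x] : ExtPow n 1) = wedge (Fin.cons x y : Fin 1 → Euc n) := by
  congr 1
  ext i : 1
  rw [Subsingleton.elim i 0]
  rfl

theorem wedge_singleton_neg (x : Euc n) : (wedge ![-x] : ExtPow n 1) = -wedge ![x] := by
  rw [wedge_singleton_eq _ Fin.elim0, wedge_singleton_eq _ Fin.elim0, ← wedgeLeft_wedge,
    ← wedgeLeft_wedge, map_neg, LinearMap.neg_apply]

theorem wedge_singleton_ne_zero {x : Euc n} (hx : x ≠ 0) : (wedge ![x] : ExtPow n 1) ≠ 0 := by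
  refine wedge_ne_zero ?_
  rw [linearIndependent_unique_iff]
  exact hx

/-- A nonzero vector annihilated by the positive functional of `K (j + 1)` is not in
`T(K₁, …, Kⱼ₊₁)`. -/
theorem notMem_TSet {j : ℕ} {B : ExtPow n (j + 1) →ₗ[ℝ] ExtPow n (j + 1)} {μ : ℝ}
    {φ : ExtPow n (j + 1) →ₗ[ℝ] ℝ} {w : ExtPow n (j + 1)} (hK : IsProperCone (K (j + 1)))
    (h : IsPerron (K (j + 1)) B μ φ w) {v : Euc n} (hv : ∀ ω, φ (wedgeLeft n j v ω) = 0)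
    (hv0 : v ≠ 0) : v ∉ TSet K (j + 1) := by
  refine fun hmem => notMem_closure_of_apply_wedgeLeft_eq_zero hK h hv hv0 ?_
  cases j with
  | zero =>
    rw [TSet_one] at hmem
    refine subset_closure ⟨Fin.elim0, ?_⟩
    rw [← wedge_singleton_eq]
    refine ⟨wedge_singleton_ne_zero hv0, hmem.imp id fun hm => ?_⟩
    rw [Set.mem_neg, ← wedge_singleton_neg]
    exact hm
  | succ j =>
    rw [TSet_add_two] at hmem
    refine closure_mono ?_ hmem
    rintro x ⟨y, -, hy⟩
    refine ⟨y, ?_, hy.imp (fun h => interior_subset h) fun h => interior_subset h⟩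
    rcases hy with hy | hy
    · exact h.ne_zero_of_mem_interior hy
    · rw [interior_neg_set] at hy
      exact neg_ne_zero.1 (h.ne_zero_of_mem_interior hy)

theorem mem_interior_firstCone {v : Euc n} (hv : (wedge ![v] : ExtPow n 1) ∈ interior (K 1)) :
    v ∈ interior (firstCone K) := by
  have hc : Continuous fun x : Euc n => (wedge ![x] : ExtPow n 1) :=
    continuous_wedge.comp (by fun_prop)
  exact mem_interior.2 ⟨(fun x => wedge ![x]) ⁻¹' interior (K 1),
    fun x hx => interior_subset (s := K 1) hx, isOpen_interior.preimage hc, hv⟩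

/-- With y fixed, the defining condition is open in the first factor. -/
theorem mem_interior_TSet {j : ℕ} {v : Euc n} {y : Fin j → Euc n}
    (hy : ∀ i : Fin j, y i ∈ TSet K (i + 1))
    (hv : wedge (Fin.cons v y : Fin (j + 1) → Euc n) ∈
      interior (K (j + 1)) ∪ interior (-K (j + 1))) : v ∈ interior (TSet K (j + 1)) := by
  have hc : Continuous fun x : Euc n => wedge (Fin.cons x y : Fin (j + 1) → Euc n) := by
    simp only [← wedgeLeft_wedge]
    exact LinearMap.continuous_of_finiteDimensional ((wedgeLeft n j).flip (wedge y))
  refine mem_interior.2 ⟨(fun x => wedge (Fin.cons x y : Fin (j + 1) → Euc n)) ⁻¹'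
    (interior (K (j + 1)) ∪ interior (-K (j + 1))), fun x hx => ?_,
    (isOpen_interior.union isOpen_interior).preimage hc, hv⟩
  cases j with
  | zero =>
    rw [TSet_one]
    rw [Set.mem_preimage, ← wedge_singleton_eq] at hx
    refine Or.imp (fun h => interior_subset (s := K 1) h) (fun h => ?_) hx
    have := interior_subset h
    rw [Set.mem_neg, ← wedge_singleton_neg] at this
    exact this
  | succ j =>
    rw [TSet_add_two]
    exact subset_closure ⟨y, hy, hx⟩

end TSet

/-! ### Assembly -/

section Main

variable {n : ℕ} {K : ∀ j : ℕ, Set (ExtPow n j)} {A : Euc n →ₗ[ℝ] Euc n}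

/-- There is no cone in degree 0; the identity on scalars supplies μ₀ = 1, so that λ₁ = μ₁. -/
theorem isDominant_map_zero (A : Euc n →ₗ[ℝ] Euc n) :
    IsDominant (exteriorPower.map 0 A) 1 (exteriorPower.zeroEquiv ℝ (Euc n)).toLinearMap
      ((exteriorPower.zeroEquiv ℝ (Euc n)).symm 1) := by
  have hid : exteriorPower.map 0 A = LinearMap.id := by
    refine ExtPow.linearMap_ext fun y => ?_
    rw [map_wedge]
    exact congrArg wedge (Subsingleton.elim _ _)
  rw [hid]
  refine ⟨one_pos, by simp, by simp, fun v => by simp, fun v => ?_⟩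
  have h1 : ∀ m : ℕ, (LinearMap.id ^ m : ExtPow n 0 →ₗ[ℝ] ExtPow n 0) v = v := fun m => by
    rw [← Module.End.one_eq_id, one_pow]; rfl
  have h2 : (exteriorPower.zeroEquiv ℝ (Euc n)) v • (exteriorPower.zeroEquiv ℝ (Euc n)).symm 1 =
      v := by
    rw [← map_smul, smul_eq_mul, mul_one, LinearEquiv.symm_apply_apply]
  simp only [h1, one_pow, inv_one, one_smul, LinearEquiv.coe_coe, h2]
  exact tendsto_const_nhds

theorem exists_isPerron_family (hK : IsTotallyPositiveStructure K) (hA : IsGSTP K A) :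
    ∃ (μ : ℕ → ℝ) (φ : ∀ j, ExtPow n j →ₗ[ℝ] ℝ) (w : ∀ j, ExtPow n j), μ 0 = 1 ∧
      (∀ j ≤ n, IsDominant (exteriorPower.map j A) (μ j) (φ j) (w j)) ∧
      ∀ j, 1 ≤ j → j ≤ n → IsPerron (K j) (exteriorPower.map j A) (μ j) (φ j) (w j) := by
  have h : ∀ j, ∃ (μ : ℝ) (φ : ExtPow n j →ₗ[ℝ] ℝ) (w : ExtPow n j), (j = 0 → μ = 1) ∧
      (j ≤ n → IsDominant (exteriorPower.map j A) μ φ w) ∧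
      (1 ≤ j → j ≤ n → IsPerron (K j) (exteriorPower.map j A) μ φ w) := by
    intro j
    rcases Nat.eq_zero_or_pos j with rfl | hj
    · exact ⟨1, _, _, fun _ => rfl, fun _ => isDominant_map_zero A, fun h => absurd h (by simp)⟩
    by_cases hjn : j ≤ n
    · have : Nontrivial (ExtPow n j) := by
        refine Module.nontrivial_of_finrank_pos (R := ℝ) ?_
        rw [exteriorPower.finrank_eq, finrank_euclideanSpace_fin]
        exact Nat.choose_pos hjn
      obtain ⟨μ, φ, w, hP⟩ := (hK j hj hjn).exists_isPerron (hA j hj hjn)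
      exact ⟨μ, φ, w, fun h0 => absurd h0 hj.ne', fun _ => hP.toIsDominant, fun _ _ => hP⟩
    · exact ⟨1, 0, 0, fun _ => rfl, fun h => absurd h hjn, fun _ h => absurd h hjn⟩
  choose μ φ w h0 h1 h2 using h
  exact ⟨μ, φ, w, h0 0 rfl, h1, h2⟩

theorem strictAnti_fin_of_forall {r : ℕ → ℝ}
    (h : ∀ i j : ℕ, 1 ≤ i → i < j → j ≤ n → r j < r i) {j : ℕ} (hj : j ≤ n) :
    StrictAnti fun i : Fin j => r (i + 1) := fun i k hik =>
  h _ _ (by omega) (by simpa using hik) (by omega)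

/-- The exterior product of the first `j` eigenvectors is dominant, hence lies in the interior of
the cone or of its negative. -/
theorem smul_wedge_mem_interior {μ : ℕ → ℝ} {φ : ∀ j, ExtPow n j →ₗ[ℝ] ℝ}
    {w : ∀ j, ExtPow n j} (hK : IsTotallyPositiveStructure K) (hμ0 : μ 0 = 1)
    (hD : ∀ j ≤ n, IsDominant (exteriorPower.map j A) (μ j) (φ j) (w j))
    (hP : ∀ j, 1 ≤ j → j ≤ n → IsPerron (K j) (exteriorPower.map j A) (μ j) (φ j) (w j))
    (hanti : ∀ i j : ℕ, 1 ≤ i → i < j → j ≤ n → quotientSeq μ j < quotientSeq μ i)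
    {x : ℕ → Euc n} (hx : ∀ i ∈ Finset.Icc 1 n, A (x i) = quotientSeq μ i • x i)
    (hx0 : ∀ i ∈ Finset.Icc 1 n, x i ≠ 0) {j : ℕ} (hj : j + 1 ≤ n) {c : ℝ} (hc : c ≠ 0) :
    c • wedgeLeft n j (x (j + 1)) (wedge fun i : Fin j => x (i + 1)) ∈
      interior (K (j + 1)) ∪ interior (-K (j + 1)) := by
  set y : Fin j → Euc n := fun i => x (i + 1) with hy
  have hyA : ∀ i : Fin j, A (y i) = quotientSeq μ (i + 1) • y i := fun i =>
    hx _ (Finset.mem_Icc.2 ⟨by omega, by omega⟩)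
  have hxj := hx (j + 1) (Finset.mem_Icc.2 ⟨by omega, hj⟩)
  have hli : LinearIndependent ℝ (Fin.snoc y (x (j + 1)) : Fin (j + 1) → Euc n) := by
    refine eigenvectors_linearIndependent_of_strictAnti (A := A)
      (strictAnti_fin_of_forall hanti hj) ?_ ?_
    · intro i
      refine Fin.lastCases ?_ (fun i => ?_) i
      · simpa using hxj
      · simpa using hyA i
    · intro i
      refine Fin.lastCases ?_ (fun i => ?_) i
      · simpa using hx0 (j + 1) (Finset.mem_Icc.2 ⟨by omega, hj⟩)
      · simpa using hx0 (i + 1) (Finset.mem_Icc.2 ⟨by omega, by omega⟩)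
  have hli' : LinearIndependent ℝ (Fin.cons (x (j + 1)) y : Fin (j + 1) → Euc n) :=
    linearIndependent_finCons.2 (linearIndependent_finSnoc.1 hli)
  have hμj := (hD j (by omega)).pos
  have heig : exteriorPower.map (j + 1) A (wedgeLeft n j (x (j + 1)) (wedge y)) =
      μ (j + 1) • wedgeLeft n j (x (j + 1)) (wedge y) := by
    rw [map_wedgeLeft, hxj, map_wedge_eigenvectors hyA,
      prod_quotientSeq hμ0 fun i hi => (hD i (by omega)).pos, map_smul, map_smul,
      LinearMap.smul_apply, smul_smul, quotientSeq, add_tsub_cancel_right,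
      mul_div_cancel₀ _ hμj.ne']
  have hne : c • wedgeLeft n j (x (j + 1)) (wedge y) ≠ 0 := by
    rw [wedgeLeft_wedge]
    exact smul_ne_zero hc (wedge_ne_zero hli')
  have hPj := hP (j + 1) (by omega) hj
  have hw := hPj.toIsDominant.eq_smul_of_map_eq heig
  rw [hw, smul_smul] at hne ⊢
  set r := c * φ (j + 1) (wedgeLeft n j (x (j + 1)) (wedge y))
  have hKj := hK (j + 1) (by omega) hj
  rcases lt_trichotomy r 0 with hr | hr | hr
  · right
    rw [interior_neg_set, Set.mem_neg, ← neg_smul]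
    exact hKj.smul_mem_interior hPj.mem_interior (neg_pos.2 hr)
  · rw [hr, zero_smul] at hne
    exact absurd rfl hne
  · left
    exact hKj.smul_mem_interior hPj.mem_interior hr

/-- Every term below the top index repeats a factor of x₁ ∧ … ∧ xⱼ. -/
theorem wedgeLeft_sum_eq {x : ℕ → Euc n} (c : ℕ → ℝ) {q j : ℕ} (hq : 1 ≤ q) (hqj : q ≤ j + 1) :
    wedgeLeft n j (∑ i ∈ Finset.Icc q (j + 1), c i • x i) (wedge fun i : Fin j => x (i + 1)) =
      c (j + 1) • wedgeLeft n j (x (j + 1)) (wedge fun i : Fin j => x (i + 1)) := by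
  rw [map_sum, LinearMap.sum_apply, Finset.sum_eq_single (j + 1)]
  · rw [map_smul, LinearMap.smul_apply]
  · intro i hi hij
    obtain ⟨hi1, hi2⟩ := Finset.mem_Icc.1 hi
    rw [map_smul, LinearMap.smul_apply, wedgeLeft_wedge]
    have h0 : wedge (Fin.cons (x i) fun i : Fin j => x (i + 1) : Fin (j + 1) → Euc n) = 0 := by
      refine (exteriorPower.ιMulti ℝ (j + 1)).map_eq_zero_of_eq _
        (i := 0) (j := Fin.succ ⟨i - 1, by omega⟩) ?_ (Fin.succ_ne_zero _).symm
      rw [Fin.cons_zero, Fin.cons_succ]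
      congr 1
      simp only
      omega
    rw [h0, smul_zero]
  · intro h
    exact absurd (Finset.mem_Icc.2 ⟨hqj, le_rfl⟩) h

end Main

theorem theorem22 (n : ℕ) (hn : 1 ≤ n) (K : ∀ j : ℕ, Set (ExtPow n j))
    (hK : IsTotallyPositiveStructure K) (A : Euc n →ₗ[ℝ] Euc n) (hA : IsGSTP K A) :
    ∃ lam : ℕ → ℝ,
      -- the complex eigenvalues of `A`, listed with algebraic multiplicities, are `lam 1, …, lam n`
      (A.charpoly.map (algebraMap ℝ ℂ)).roots =
        (Finset.Icc 1 n).val.map (fun i => (lam i : ℂ)) ∧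
      (∀ i ∈ Finset.Icc 1 n, Module.End.HasEigenvalue A (lam i)) ∧
      spectralRadius ℂ (A.baseChange ℂ : Module.End ℂ (TensorProduct ℝ ℂ (Euc n))) =
        ENNReal.ofReal (lam 1) ∧
      (∀ i j : ℕ, 1 ≤ i → i < j → j ≤ n → lam j < lam i) ∧
      0 < lam n ∧
      -- every choice of eigenvectors
      ∀ x : ℕ → Euc n,
        (∀ i ∈ Finset.Icc 1 n, Module.End.HasEigenvector A (lam i) (x i)) →
        (x 1 ∈ interior (firstCone K) ∨ -x 1 ∈ interior (firstCone K)) ∧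
        (∀ j ∈ Finset.Icc 1 n, x j ∈ interior (TSet K j) \ TSet K (j - 1)) ∧
        (∀ (c : ℕ → ℝ) (q p : ℕ), 1 ≤ q → q ≤ p → p ≤ n → c p ≠ 0 →
          ∑ i ∈ Finset.Icc q p, c i • x i ∈ interior (TSet K p) \ TSet K (q - 1)) ∧
        (∀ (c : ℕ → ℝ) (q p : ℕ), 1 ≤ q → q ≤ p → p ≤ n →
          ∑ i ∈ Finset.Icc q p, c i • x i ∈ closure (TSet K p \ TSet K (q - 1))) := by
  obtain ⟨μ, φ, w, hμ0, hD, hP⟩ := exists_isPerron_family hK hA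
  obtain ⟨v, hv0, hv, hvanti⟩ := exists_eigenvectors hD hμ0
  have hpos : ∀ i ∈ Finset.Icc 1 n, 0 < quotientSeq μ i := fun i hi => by
    obtain ⟨hi1, hi2⟩ := Finset.mem_Icc.1 hi
    exact div_pos (hD i hi2).pos (hD (i - 1) (by omega)).pos
  have hanti : ∀ i j : ℕ, 1 ≤ i → i < j → j ≤ n → quotientSeq μ j < quotientSeq μ i := by
    intro i j hi hij hj
    have := hvanti (a := ⟨i - 1, by omega⟩) (b := ⟨j - 1, by omega⟩)
      (by rw [Fin.lt_def]; simp only; omega)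
    simpa only [Nat.sub_add_cancel hi, Nat.sub_add_cancel (hi.trans hij.le)] using this
  have heig : ∀ i ∈ Finset.Icc 1 n, Module.End.HasEigenvalue A (quotientSeq μ i) := by
    intro i hi
    obtain ⟨hi1, hi2⟩ := Finset.mem_Icc.1 hi
    have := hv ⟨i - 1, by omega⟩
    simp only [Nat.sub_add_cancel hi1] at this
    exact Module.End.hasEigenvalue_of_hasEigenvector
      (Module.End.hasEigenvector_iff.2 ⟨Module.End.mem_eigenspace_iff.2 this, hv0 _⟩)
  have hinj : Set.InjOn (quotientSeq μ) (Finset.Icc 1 n) := by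
    intro i hi k hk hik
    obtain ⟨hi1, hi2⟩ := Finset.mem_Icc.1 hi
    obtain ⟨hk1, hk2⟩ := Finset.mem_Icc.1 hk
    rcases lt_trichotomy i k with h | h | h
    · exact absurd hik (hanti i k hi1 h hk2).ne'
    · exact h
    · exact absurd hik (hanti k i hk1 h hi2).ne
  have hroots := roots_charpoly_map_eq hinj heig
  refine ⟨quotientSeq μ, hroots, heig, spectralRadius_baseChange_eq hn hanti hpos hroots, hanti,
    hpos n (Finset.mem_Icc.2 ⟨hn, le_rfl⟩), fun x hx => ?_⟩
  have hxA : ∀ i ∈ Finset.Icc 1 n, A (x i) = quotientSeq μ i • x i := fun i hi =>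
    (hx i hi).apply_eq_smul
  have hx0 : ∀ i ∈ Finset.Icc 1 n, x i ≠ 0 := fun i hi => (hx i hi).2
  have hwedge : ∀ (c : ℕ → ℝ) (q j : ℕ), 1 ≤ q → q ≤ j + 1 → j + 1 ≤ n → c (j + 1) ≠ 0 →
      wedge (Fin.cons (∑ i ∈ Finset.Icc q (j + 1), c i • x i)
        (fun i : Fin j => x (i + 1)) : Fin (j + 1) → Euc n) ∈
        interior (K (j + 1)) ∪ interior (-K (j + 1)) := by
    intro c q j hq hqj hj hc
    rw [← wedgeLeft_wedge, wedgeLeft_sum_eq c hq hqj]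
    exact smul_wedge_mem_interior hK hμ0 hD hP hanti hxA hx0 hj hc
  have hwedge' : ∀ j : ℕ, j + 1 ≤ n →
      wedge (Fin.cons (x (j + 1)) (fun i : Fin j => x (i + 1)) : Fin (j + 1) → Euc n) ∈
        interior (K (j + 1)) ∪ interior (-K (j + 1)) := by
    intro j hj
    simpa using hwedge (fun _ => 1) (j + 1) j (by omega) le_rfl hj one_ne_zero
  have hT : ∀ j : ℕ, j + 1 ≤ n → x (j + 1) ∈ TSet K (j + 1) := by
    intro j
    induction j using Nat.strong_induction_on with
    | _ j ih =>
      intro hj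
      exact interior_subset (mem_interior_TSet (fun i => ih i i.2 (by omega)) (hwedge' j hj))
  have hmain : ∀ (c : ℕ → ℝ) (q p : ℕ), 1 ≤ q → q ≤ p → p ≤ n → c p ≠ 0 →
      ∑ i ∈ Finset.Icc q p, c i • x i ∈ interior (TSet K p) \ TSet K (q - 1) := by
    intro c q p hq hqp hp hc
    obtain ⟨j, rfl⟩ : ∃ j, p = j + 1 := ⟨p - 1, by omega⟩
    have hmem := hwedge c q j hq hqp hp hc
    refine ⟨mem_interior_TSet (fun i => hT i (by omega)) hmem, ?_⟩
    have hs0 : ∑ i ∈ Finset.Icc q (j + 1), c i • x i ≠ 0 := by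
      intro h0
      rw [h0, ← wedgeLeft_wedge, map_zero, LinearMap.zero_apply, interior_neg_set] at hmem
      have hPj := hP (j + 1) (by omega) hp
      rcases hmem with h | h
      · exact hPj.ne_zero_of_mem_interior h rfl
      · exact hPj.ne_zero_of_mem_interior h neg_zero
    -- For q = 1 the excluded set is {0}. For q = k + 2 all eigenvalues in the sum are below
    -- λ_(k+1), so the sum decays and is annihilated by φ_(k+1).
    obtain rfl | ⟨k, rfl⟩ : q = 1 ∨ ∃ k, q = k + 2 := by
      rcases hq.eq_or_lt with h | h
      · exact Or.inl h.symm
      · exact Or.inr ⟨q - 2, by omega⟩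
    · simpa [TSet_zero] using hs0
    · refine notMem_TSet (hK (k + 1) (by omega) (by omega)) (hP (k + 1) (by omega) (by omega))
        (fun ω => ?_) hs0
      refine (hD k (by omega)).apply_wedgeLeft_eq_zero (hD (k + 1) (by omega)) ?_ ω
      refine Submodule.sum_mem _ fun i hi => Submodule.smul_mem _ _ ?_
      obtain ⟨hi1, hi2⟩ := Finset.mem_Icc.1 hi
      have hi' : i ∈ Finset.Icc 1 n := Finset.mem_Icc.2 ⟨by omega, by omega⟩
      exact mem_decaySubmodule_of_lt (hpos i hi')
        (hanti (k + 1) i (by omega) (by omega) (by omega)) (hxA i hi')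
  refine ⟨?_, fun j hj => ?_, hmain, fun c q p hq hqp hp => ?_⟩
  · have h := hwedge' 0 hn
    rw [← wedge_singleton_eq, interior_neg_set] at h
    refine Or.imp (fun h => mem_interior_firstCone h) (fun h => mem_interior_firstCone ?_) h
    rw [wedge_singleton_neg]
    exact h
  · obtain ⟨hj1, hjn⟩ := Finset.mem_Icc.1 hj
    simpa using hmain (fun _ => 1) j j hj1 le_rfl hjn one_ne_zero
  · by_cases hc : c p = 0
    · have hmem : p ∈ Finset.Icc q p := Finset.mem_Icc.2 ⟨hqp, le_rfl⟩
      -- When the top coefficient vanishes, the sum is a limit of sums with top coefficient t ≠ 0.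
      have hsum : ∀ t : ℝ, ∑ i ∈ Finset.Icc q p, Function.update c p t i • x i =
          ∑ i ∈ Finset.Icc q p, c i • x i + t • x p := by
        intro t
        rw [← Finset.add_sum_erase _ _ hmem, ← Finset.add_sum_erase _ (fun i => c i • x i) hmem,
          Function.update_self, hc, zero_smul, zero_add, add_comm]
        congr 1
        refine Finset.sum_congr rfl fun i hi => ?_
        rw [Function.update_of_ne (Finset.ne_of_mem_erase hi)]
      have hlim : Tendsto (fun t : ℝ => ∑ i ∈ Finset.Icc q p, c i • x i + t • x p) (𝓝[≠] 0)
          (𝓝 (∑ i ∈ Finset.Icc q p, c i • x i)) := by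
        have hcont : Continuous fun t : ℝ => ∑ i ∈ Finset.Icc q p, c i • x i + t • x p := by
          fun_prop
        simpa using (hcont.tendsto 0).mono_left nhdsWithin_le_nhds
      refine mem_closure_of_tendsto hlim ?_
      filter_upwards [self_mem_nhdsWithin] with t ht
      rw [← hsum]
      have := hmain (Function.update c p t) q p hq hqp hp (by simpa using ht)
      exact ⟨interior_subset this.1, this.2⟩
    · have := hmain c q p hq hqp hp hc
      exact subset_closure ⟨interior_subset this.1, this.2⟩
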